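/- **Setting.** Let $\Gamma$ be the resolution graph of a good resolution of a normal surface singularity whose link is a rational homology sphere; that is, $\Gamma$ is a finite tree with vertex set $\mathcal V$, all of whose vertices are rational, with integral Euler decorations $e_i$ and with negative definite intersection form on $L=\mathbb Z\langle E_i\rangle_{i\in\mathcal V}$, where $(E_i,E_i)=e_i$ and, for $i\ne j$, $(E_i,E_j)=1$ if $i,j$ are adjacent and $0$ otherwise. Let $L'=\{l'\in L\otimes\mathbb Q:(l',L)\subset\mathbb Z\}$, $H=L'/L$, and let $\mathcal S'=\{l'\in L':(l',E_i)\le 0\ \text{for all } i\}$ be the Lipman cone. Write $\le$ for the coefficientwise order and $E_J=\sum_{i\in J}E_i$. Fix $h\in H$; let $s_h$ be the unique least element of $\mathcal S'$ with class $h$, let $Z_K\in L'$ be defined by $(Z_K,E_i)=(E_i,E_i)+2$ for all $i$, put $k_h=-Z_K+2s_h$ and $\chi_h(l)=-\tfrac12(l,l+k_h)\in\mathbb Z$ for $l\in L$. A pair $(l,I)$, $l\in L$, $I\subset\mathcal V$, denotes the $|I|$-dimensional cube in $\mathbb R^{\mathcal V}$ with vertices $l+E_J$, $J\subset I$; its weight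 is $w_h((l,I))=\max_{J\subset I}\chi_h(l+E_J)$. Let $S_n$ be the union of the cubes of weight at most $n$ and $\mathfrak X=(\mathbb R_{\ge0})^{\mathcal V}$. Fix $s\in\mathcal S'\setminus\{0\}$. Put $n_i=-(s,E_i)\ge 0$, $\mathrm{Supp}(s)=\{i:n_i>0\}$ and $d(l)=-(s,l)=\sum_{i\in\mathrm{Supp}(s)}n_il_i$. For $d\ge 0$ let $\mathfrak X_{-d}\subset\mathfrak X$ be the union of the cubes $(l,I)$ with $l\ge0$ and $d(l)\ge d$; for $\widetilde l\in(\mathbb Z_{\ge0})^{\mathrm{Supp}(s)}$ let $\mathfrak X_{-\widetilde l}=\prod_{i\in\mathrm{Supp}(s)}[\widetilde l_i,\infty)\times\prod_{i\notin\mathrm{Supp}(s)}[0,\infty)$ and $d(\widetilde l)=\sum_{i\in \mathrm{Supp}(s)} n_i\widetilde l_i$. Homology of these cubical spaces is computed by the chain complex generated by their cubes. Define the formal series $$PE_1(T,Q,\mathfrak h)=\sum_{d\ge0,\,n\in\mathbb Z,\,b\ge0}\operatorname{rank}H_b(S_n\cap\mathfrak X_{-d},\,S_n\cap\mathfrak X_{-d-1};\mathbb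 Z)\;T^dQ^n\mathfrak h^b,$$ $$\mathbf{PE}_1(\mathbf T,Q,\mathfrak h)=\sum_{\widetilde l\in(\mathbb Z_{\ge0})^{\mathrm{Supp}(s)},\,n\in\mathbb Z,\,b\ge0}\operatorname{rank}H_b(S_n\cap\mathfrak X_{-\widetilde l},\,S_n\cap\mathfrak X_{-\widetilde l}\cap\mathfrak X_{-d(\widetilde l)-1};\mathbb Z)\Big(\prod_{i\in\mathrm{Supp}(s)}T_i^{n_i\widetilde l_i}\Big)Q^n\mathfrak h^b .$$ **Theorem.** For all such $\Gamma$, $h$ and $s$ the following formal sums are well defined (each monomial occurs in only finitely many summands, and the exponents are bounded below), and the following identities of formal series hold. (a) $$PE_1(T,Q,\mathfrak h)|_{\mathfrak h=-1}=\frac1{1-Q}\sum_{(l,I)\subset\mathfrak X}(-1)^{|I|}T^{d(l)}Q^{w_h((l,I))}=\frac1{1-Q}\sum_{l\in L,\ l\ge 0}T^{d(l)}\sum_{I\subset\mathcal V}(-1)^{|I|}Q^{w_h((l,I))}.$$ In the last expression the sum over $\{l\in L: l\ge0\}$ can be replaced by the sum over all $l\in L$. (b) $$\mathbf{PE}_1(\mathbf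 T,Q,\mathfrak h)|_{\mathfrak h=-1}=\frac1{1-Q}\sum_{l\in L,\ l\ge 0}\Big(\prod_{i\in\mathrm{Supp}(s)}T_i^{n_il_i}\Big)\sum_{I\subset\mathcal V}(-1)^{|I|}Q^{w_h((l,I))},$$ and again the sum over $\{l\in L: l\ge0\}$ can be replaced by the sum over all $l\in L$. -/

import Mathlib

/-! ### Resolution graphs and their lattices -/

open Classical in
/-- The intersection matrix of a graph with Euler decorations `e`:
`(E_i, E_i) = e_i`, and for `i ≠ j` the number `(E_i, E_j)` is `1` if `i, j` are joined by an edge,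
and `0` otherwise. -/
noncomputable def intersectionMatrix {V : Type*} (G : SimpleGraph V) (e : V → ℤ) : Matrix V V ℤ :=
  fun i j => if i = j then e i else if G.Adj i j then 1 else 0

/-- A (good) resolution graph of a normal surface singularity whose link is a rational homology
sphere: a tree of rational vertices with integral Euler decorations and negative definite
intersection form. -/
structure ResolutionGraph (V : Type*) [Fintype V] where
  graph : SimpleGraph V
  euler : V → ℤ
  isTree : graph.IsTree
  negDef : ∀ x : V → ℚ, x ≠ 0 →
    x ⬝ᵥ ((intersectionMatrix graph euler).map (Int.cast : ℤ → ℚ)).mulVec x < 0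

/-- A lattice point `∑ l_i E_i` of `L = ℤ^V` as an element of `L ⊗ ℚ`. -/
def latQ {V : Type*} (l : V → ℤ) : V → ℚ := fun i => (l i : ℚ)

/-- `E_J = ∑_{i ∈ J} E_i` as a lattice point. -/
def indicatorE {V : Type*} [DecidableEq V] (J : Finset V) : V → ℤ := fun i => if i ∈ J then 1 else 0

namespace ResolutionGraph

section Lattice

variable {V : Type*} [Fintype V] (Γ : ResolutionGraph V)

/-- The intersection matrix with rational entries. -/
noncomputable def matQ : Matrix V V ℚ := (intersectionMatrix Γ.graph Γ.euler).map (Int.cast : ℤ → ℚ)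

/-- The intersection form `(x, y)` on `L ⊗ ℚ`. -/
noncomputable def pair (x y : V → ℚ) : ℚ := x ⬝ᵥ Γ.matQ.mulVec y

lemma pair_add_left (x y z : V → ℚ) : Γ.pair (x + y) z = Γ.pair x z + Γ.pair y z := by
  simp [pair, add_dotProduct]

lemma pair_add_right (x y z : V → ℚ) : Γ.pair x (y + z) = Γ.pair x y + Γ.pair x z := by
  simp [pair, Matrix.mulVec_add, dotProduct_add]

lemma pair_smul_left (c : ℚ) (x z : V → ℚ) : Γ.pair (c • x) z = c * Γ.pair x z := by
  simp [pair]

lemma pair_neg_left (x z : V → ℚ) : Γ.pair (-x) z = - Γ.pair x z := by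
  simp [pair]

lemma matQ_symm (i j : V) : Γ.matQ i j = Γ.matQ j i := by
  simp only [matQ, Matrix.map_apply, intersectionMatrix]
  by_cases hij : i = j
  · subst hij; rfl
  · by_cases ha : Γ.graph.Adj i j
    · simp [hij, Ne.symm hij, ha, ha.symm]
    · have hb : ¬ Γ.graph.Adj j i := fun h => ha h.symm
      simp [hij, Ne.symm hij, ha, hb]

lemma pair_comm (x y : V → ℚ) : Γ.pair x y = Γ.pair y x := by
  have hT : Γ.matQ.transpose = Γ.matQ := by
    ext i j; exact Γ.matQ_symm j i
  unfold pair
  rw [Matrix.dotProduct_mulVec, dotProduct_comm, ← Matrix.mulVec_transpose, hT]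

lemma pair_self_nonpos (x : V → ℚ) : Γ.pair x x ≤ 0 := by
  by_cases hx : x = 0
  · simp [hx, pair]
  · exact (Γ.negDef x hx).le

lemma isUnit_det_matQ [DecidableEq V] : IsUnit Γ.matQ.det := by
  rw [isUnit_iff_ne_zero]
  intro hdet
  obtain ⟨v, hv, hv0⟩ := Matrix.exists_mulVec_eq_zero_iff.mpr hdet
  have := Γ.negDef v hv
  change v ⬝ᵥ Γ.matQ.mulVec v < 0 at this
  simp [hv0] at this

/-- The dual lattice `L' = {l' ∈ L ⊗ ℚ : (l', L) ⊆ ℤ}`. -/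
def dualLattice : AddSubgroup (V → ℚ) where
  carrier := {x | ∀ l : V → ℤ, ∃ m : ℤ, Γ.pair x (latQ l) = m}
  zero_mem' := fun l => ⟨0, by simp [pair]⟩
  add_mem' := by
    intro x y hx hy l
    obtain ⟨a, ha⟩ := hx l
    obtain ⟨b, hb⟩ := hy l
    exact ⟨a + b, by rw [pair_add_left, ha, hb]; push_cast; ring⟩
  neg_mem' := by
    intro x hx l
    obtain ⟨a, ha⟩ := hx l
    exact ⟨-a, by rw [pair_neg_left, ha]; push_cast; ring⟩

/-- `L` as a subgroup of `L ⊗ ℚ`. -/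
def lattice (_Γ : ResolutionGraph V) : AddSubgroup (V → ℚ) where
  carrier := Set.range latQ
  zero_mem' := ⟨0, by ext; simp [latQ]⟩
  add_mem' := by
    rintro _ _ ⟨a, rfl⟩ ⟨b, rfl⟩
    exact ⟨a + b, by ext; simp [latQ]⟩
  neg_mem' := by
    rintro _ ⟨a, rfl⟩
    exact ⟨-a, by ext; simp [latQ]⟩

/-- `H = L' / L`. -/
abbrev H : Type _ := Γ.dualLattice ⧸ Γ.lattice.addSubgroupOf Γ.dualLattice

/-- The integral pairing `L' × L → ℤ`. -/
noncomputable def dualPair (x : Γ.dualLattice) (l : V → ℤ) : ℤ := ⌊Γ.pair x (latQ l)⌋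

lemma dualPair_cast (x : Γ.dualLattice) (l : V → ℤ) :
    ((Γ.dualPair x l : ℤ) : ℚ) = Γ.pair x (latQ l) := by
  obtain ⟨m, hm⟩ := x.2 l
  simp [dualPair, hm]

variable [DecidableEq V]

/-- The Lipman cone `S' = {l' ∈ L' : (l', E_i) ≤ 0 for all i}`. -/
def lipmanCone : Set Γ.dualLattice := {x | ∀ i : V, Γ.dualPair x (indicatorE {i}) ≤ 0}

lemma latQ_indicatorE_singleton (i : V) : latQ (indicatorE {i}) = Pi.single i (1 : ℚ) := by
  ext j
  by_cases hj : j = i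
  · subst hj; simp [latQ, indicatorE]
  · simp [latQ, indicatorE, hj]

lemma pair_E (x : V → ℚ) (i : V) :
    Γ.pair x (latQ (indicatorE {i})) = Γ.matQ.mulVec x i := by
  rw [pair_comm, latQ_indicatorE_singleton, pair, single_dotProduct, one_mul]

lemma mem_lipmanCone_iff (x : Γ.dualLattice) :
    x ∈ Γ.lipmanCone ↔ ∀ i, Γ.matQ.mulVec x i ≤ 0 := by
  refine forall_congr' fun i => ?_
  rw [← pair_E, ← dualPair_cast]
  exact_mod_cast Iff.rfl

lemma nonneg_of_mulVec_nonpos (x : V → ℚ) (hx : ∀ i, Γ.matQ.mulVec x i ≤ 0) : 0 ≤ x := by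
  by_contra hneg
  set y : V → ℚ := fun i => max (-x i) 0 with hy
  set p : V → ℚ := fun i => max (x i) 0 with hp
  have hxyp : x = p + (-y) := by
    ext i
    simp only [hy, hp, Pi.add_apply, Pi.neg_apply]
    rcases le_total 0 (x i) with h | h
    · rw [max_eq_left h, max_eq_right (by linarith)]; ring
    · rw [max_eq_right h, max_eq_left (by linarith)]; ring
  have hy0 : y ≠ 0 := by
    intro h0
    apply hneg
    intro i
    have := congrFun h0 i
    simp only [hy, Pi.zero_apply] at this
    have h2 := le_max_left (-x i) 0
    simp only [Pi.zero_apply]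
    linarith
  have h1 : Γ.pair y x ≤ 0 := by
    unfold pair dotProduct
    refine Finset.sum_nonpos fun i _ => ?_
    exact mul_nonpos_of_nonneg_of_nonpos (le_max_right _ _) (hx i)
  have h2 : 0 ≤ Γ.pair y p := by
    unfold pair dotProduct Matrix.mulVec dotProduct
    refine Finset.sum_nonneg fun i _ => ?_
    rw [Finset.mul_sum]
    refine Finset.sum_nonneg fun j _ => ?_
    by_cases hij : i = j
    · subst hij
      have : y i * p i = 0 := by
        simp only [hy, hp]
        rcases le_total 0 (x i) with h | h
        · rw [max_eq_right (by linarith : -x i ≤ 0)]; ring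
        · rw [max_eq_right h]; ring
      have h3 : y i * (Γ.matQ i i * p i) = Γ.matQ i i * (y i * p i) := by ring
      rw [h3, this]; simp
    · refine mul_nonneg (le_max_right _ _) (mul_nonneg ?_ (le_max_right _ _))
      simp only [matQ, Matrix.map_apply, intersectionMatrix, hij, if_false]
      split_ifs <;> simp
  have h3 : Γ.pair y y < 0 := Γ.negDef y hy0
  have h4 : Γ.pair y x = Γ.pair y p - Γ.pair y y := by
    rw [hxyp, pair_add_right, Γ.pair_comm y (-y), pair_neg_left]; ring
  linarith

lemma mulVec_min_nonpos (x y : V → ℚ) (hx : ∀ i, Γ.matQ.mulVec x i ≤ 0)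
    (hy : ∀ i, Γ.matQ.mulVec y i ≤ 0) (i : V) : Γ.matQ.mulVec (x ⊓ y) i ≤ 0 := by
  have key : ∀ z : V → ℚ, (∀ i, Γ.matQ.mulVec z i ≤ 0) → x ⊓ y ≤ z → (x ⊓ y) i = z i →
      Γ.matQ.mulVec (x ⊓ y) i ≤ 0 := by
    intro z hz hle heq
    refine le_trans ?_ (hz i)
    unfold Matrix.mulVec dotProduct
    refine Finset.sum_le_sum fun j _ => ?_
    by_cases hij : i = j
    · subst hij; rw [heq]
    · refine mul_le_mul_of_nonneg_left (hle j) ?_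
      simp only [matQ, Matrix.map_apply, intersectionMatrix, hij, if_false]
      split_ifs <;> simp
  rcases le_total (x i) (y i) with h | h
  · exact key x hx inf_le_left (by simp [h])
  · exact key y hy inf_le_right (by simp [h])

/-- A lattice point whose intersection with every `E_i` is at most `-1`. -/
lemma exists_ample : ∃ Z : V → ℤ, ∀ i, Γ.matQ.mulVec (latQ Z) i ≤ -1 := by
  set M : Matrix V V ℤ := intersectionMatrix Γ.graph Γ.euler with hM
  have hdetQ : Γ.matQ.det = (M.det : ℚ) := by
    unfold matQ
    exact (RingHom.map_det (Int.castRingHom ℚ) M).symm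
  have hdet : M.det ≠ 0 := by
    intro h0
    have := Γ.isUnit_det_matQ
    rw [hdetQ, h0] at this
    simp at this
  refine ⟨M.adjugate.mulVec (fun _ => -M.det), fun i => ?_⟩
  have hcast : Γ.matQ.mulVec (latQ (M.adjugate.mulVec (fun _ => -M.det))) i
      = ((M.mulVec (M.adjugate.mulVec (fun _ => -M.det)) i : ℤ) : ℚ) := by
    simp only [matQ, Matrix.mulVec, dotProduct, latQ, Matrix.map_apply]
    push_cast
    rfl
  rw [hcast, Matrix.mulVec_mulVec, Matrix.mul_adjugate]
  have : (M.det • (1 : Matrix V V ℤ)).mulVec (fun _ => -M.det) i = -(M.det * M.det) := by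
    rw [Matrix.smul_mulVec, Matrix.one_mulVec]; simp
  rw [this]
  have h1 : 1 ≤ M.det * M.det := by
    have := mul_self_pos.mpr hdet
    omega
  have h2 : -(M.det * M.det) ≤ -1 := by omega
  exact_mod_cast h2

lemma mem_lattice_latQ (l : V → ℤ) : latQ l ∈ Γ.lattice := ⟨l, rfl⟩

lemma matQ_latQ_int (l : V → ℤ) (i : V) : ∃ m : ℤ, Γ.matQ.mulVec (latQ l) i = m := by
  refine ⟨(intersectionMatrix Γ.graph Γ.euler).mulVec l i, ?_⟩
  simp only [matQ, Matrix.mulVec, dotProduct, latQ, Matrix.map_apply]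
  push_cast
  rfl

lemma latQ_mem_dualLattice (l : V → ℤ) : latQ l ∈ Γ.dualLattice := by
  intro m
  choose f hf using fun i => Γ.matQ_latQ_int m i
  refine ⟨∑ i, l i * f i, ?_⟩
  unfold pair dotProduct
  push_cast
  exact Finset.sum_congr rfl fun i _ => by rw [hf i]; rfl

/-- Every class of `L'/L` has a least representative in the Lipman cone. -/
lemma exists_isLeast_lipmanCone (h : Γ.H) :
    ∃ x : Γ.dualLattice, IsLeast {x | x ∈ Γ.lipmanCone ∧ (QuotientAddGroup.mk x : Γ.H) = h} x := by
  set A : Set Γ.dualLattice := {x | x ∈ Γ.lipmanCone ∧ (QuotientAddGroup.mk x : Γ.H) = h} with hA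
  have hne : A.Nonempty := by
    obtain ⟨y, rfl⟩ := QuotientAddGroup.mk_surjective h
    obtain ⟨Z, hZ⟩ := Γ.exists_ample
    obtain ⟨N, hN⟩ : ∃ N : ℕ, ∀ i, Γ.matQ.mulVec y i ≤ N := by
      obtain ⟨B, hB⟩ := (Set.finite_range (fun i => Γ.matQ.mulVec y i)).bddAbove
      obtain ⟨N, hN⟩ := exists_nat_ge B
      exact ⟨N, fun i => (hB ⟨i, rfl⟩).trans hN⟩
    refine ⟨y + ⟨latQ ((N : ℤ) • Z), Γ.latQ_mem_dualLattice _⟩, ?_, ?_⟩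
    · rw [mem_lipmanCone_iff]
      intro i
      have hs : latQ ((N : ℤ) • Z) = (N : ℚ) • latQ Z := by ext; simp [latQ]
      simp only [AddSubgroup.coe_add, Matrix.mulVec_add, Pi.add_apply, hs, Matrix.mulVec_smul,
        Pi.smul_apply, smul_eq_mul]
      have hNn : (0 : ℚ) ≤ N := Nat.cast_nonneg N
      nlinarith [hN i, hZ i]
    · rw [QuotientAddGroup.eq_iff_sub_mem, AddSubgroup.mem_addSubgroupOf]
      simpa using Γ.mem_lattice_latQ ((N : ℤ) • Z)
  have hnn : ∀ x ∈ A, (0 : V → ℚ) ≤ x := fun x hx =>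
    Γ.nonneg_of_mulVec_nonpos _ ((Γ.mem_lipmanCone_iff x).1 hx.1)
  obtain ⟨x, hxA, hxmin⟩ := WellFounded.has_min (InvImage.wf
    (fun x : Γ.dualLattice => ⌊∑ i, (x : V → ℚ) i⌋₊) Nat.lt_wfRel.wf) A hne
  refine ⟨x, hxA, fun z hz => ?_⟩
  obtain ⟨a, ha⟩ : ∃ a : V → ℤ, latQ a = (x : V → ℚ) - z := by
    have : (QuotientAddGroup.mk x : Γ.H) = QuotientAddGroup.mk z := hxA.2.trans hz.2.symm
    rw [QuotientAddGroup.eq_iff_sub_mem, AddSubgroup.mem_addSubgroupOf] at this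
    obtain ⟨a, ha⟩ := this
    exact ⟨a, by simpa using ha⟩
  set c : V → ℤ := fun i => max (a i) 0 with hc
  have hmin : (x : V → ℚ) ⊓ z = (x : V → ℚ) - latQ c := by
    ext i
    have hai : (a i : ℚ) = (x : V → ℚ) i - (z : V → ℚ) i := congrFun ha i
    simp only [Pi.inf_apply, Pi.sub_apply, latQ, hc]
    rcases le_total (a i) 0 with h0 | h0
    · have h0' : (a i : ℚ) ≤ 0 := by exact_mod_cast h0
      rw [max_eq_right h0, inf_eq_left.mpr (by linarith)]; simp
    · have h0' : (0 : ℚ) ≤ a i := by exact_mod_cast h0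
      rw [max_eq_left h0, inf_eq_right.mpr (by linarith), hai]; ring
  set w : Γ.dualLattice := x - ⟨latQ c, Γ.latQ_mem_dualLattice c⟩ with hw
  have hwQ : (w : V → ℚ) = (x : V → ℚ) ⊓ z := by rw [hmin]; simp [hw]
  have hwA : w ∈ A := by
    refine ⟨?_, ?_⟩
    · rw [mem_lipmanCone_iff, hwQ]
      exact Γ.mulVec_min_nonpos _ _ ((Γ.mem_lipmanCone_iff x).1 hxA.1)
        ((Γ.mem_lipmanCone_iff z).1 hz.1)
    · rw [← hxA.2, QuotientAddGroup.eq_iff_sub_mem, AddSubgroup.mem_addSubgroupOf]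
      simpa [hw] using Γ.mem_lattice_latQ c
  have hnot := hxmin w hwA
  have hc0 : ∀ i, 0 ≤ c i := fun i => le_max_right _ _
  have hsum : ∑ i, (w : V → ℚ) i = ∑ i, (x : V → ℚ) i - ((∑ i, c i : ℤ) : ℚ) := by
    rw [hwQ, hmin]; push_cast; simp [latQ, Finset.sum_sub_distrib]
  have hwpos : 0 ≤ ∑ i, (w : V → ℚ) i := Finset.sum_nonneg fun i _ => hnn w hwA i
  have hcs : ∑ i, c i ≤ 0 := by
    by_contra hlt
    push Not at hlt
    apply hnot
    change ⌊∑ i, (w : V → ℚ) i⌋₊ < ⌊∑ i, (x : V → ℚ) i⌋₊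
    have h1 : (1 : ℚ) ≤ ((∑ i, c i : ℤ) : ℚ) := by exact_mod_cast hlt
    have h2 : ⌊∑ i, (w : V → ℚ) i + 1⌋₊ ≤ ⌊∑ i, (x : V → ℚ) i⌋₊ :=
      Nat.floor_le_floor (by rw [hsum]; linarith)
    rw [Nat.floor_add_one hwpos] at h2
    omega
  have hcz : ∀ i, c i = 0 := by
    have := (Finset.sum_eq_zero_iff_of_nonneg (fun i _ => hc0 i)).1
      (le_antisymm hcs (Finset.sum_nonneg fun i _ => hc0 i))
    exact fun i => this i (Finset.mem_univ i)
  intro i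
  have hai : (a i : ℚ) = (x : V → ℚ) i - (z : V → ℚ) i := congrFun ha i
  have h0 : a i ≤ 0 := by
    have := hcz i
    simp only [hc] at this
    exact max_eq_right_iff.mp this
  have h0' : (a i : ℚ) ≤ 0 := by exact_mod_cast h0
  change (x : V → ℚ) i ≤ (z : V → ℚ) i
  linarith

/-- `s_h`, the least element of the Lipman cone in the class `h`. -/
noncomputable def leastRep (h : Γ.H) : Γ.dualLattice := (Γ.exists_isLeast_lipmanCone h).choose

lemma leastRep_isLeast (h : Γ.H) :
    IsLeast {x | x ∈ Γ.lipmanCone ∧ (QuotientAddGroup.mk x : Γ.H) = h} (Γ.leastRep h) :=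
  (Γ.exists_isLeast_lipmanCone h).choose_spec

/-- The anticanonical cycle `Z_K`, determined by `(Z_K, E_i) = (E_i, E_i) + 2` for all `i`. -/
noncomputable def ZK : V → ℚ := (Γ.matQ)⁻¹.mulVec (fun i => (Γ.euler i : ℚ) + 2)

lemma adjunction (i : V) :
    Γ.pair Γ.ZK (latQ (indicatorE {i})) = (Γ.euler i : ℚ) + 2 := by
  rw [pair_E, ZK, Matrix.mulVec_mulVec, Matrix.mul_nonsing_inv _ Γ.isUnit_det_matQ,
    Matrix.one_mulVec]

/-- The distinguished characteristic element `k_h = -Z_K + 2 s_h`. -/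
noncomputable def kh (h : Γ.H) : V → ℚ := -Γ.ZK + (2 : ℚ) • (Γ.leastRep h : V → ℚ)

/-- The weight function `χ_h(l) = -(l, l + k_h) / 2`, an integer by `chi_cast`. -/
noncomputable def chi (h : Γ.H) (l : V → ℤ) : ℤ :=
  ⌊-(1 / 2) * Γ.pair (latQ l) (latQ l + Γ.kh h)⌋

lemma latQ_add (l m : V → ℤ) : latQ (l + m) = latQ l + latQ m := by ext; simp [latQ]

lemma latQ_neg (l : V → ℤ) : latQ (-l) = -latQ l := by ext; simp [latQ]

lemma chi_cast (h : Γ.H) (l : V → ℤ) :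
    ((Γ.chi h l : ℤ) : ℚ) = -(1 / 2) * Γ.pair (latQ l) (latQ l + Γ.kh h) := by
  suffices hint : ∃ m : ℤ, -(1 / 2) * Γ.pair (latQ l) (latQ l + Γ.kh h) = m by
    obtain ⟨m, hm⟩ := hint
    rw [chi, hm, Int.floor_intCast]
  have hLL : ∀ a b : V → ℤ, ∃ m : ℤ, Γ.pair (latQ a) (latQ b) = m := fun a b =>
    Γ.latQ_mem_dualLattice a b
  let S : AddSubgroup (V → ℤ) :=
    { carrier := {l | ∃ m : ℤ, -(1 / 2) * Γ.pair (latQ l) (latQ l + Γ.kh h) = m}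
      zero_mem' := ⟨0, by
        have : latQ (0 : V → ℤ) = 0 := by ext; simp [latQ]
        simp [pair, this]⟩
      add_mem' := by
        rintro a b ⟨m, hm⟩ ⟨n, hn⟩
        obtain ⟨p, hp⟩ := hLL a b
        refine ⟨m + n - p, ?_⟩
        push_cast
        rw [← hm, ← hn, ← hp, latQ_add]
        simp only [pair_add_left, pair_add_right]
        rw [Γ.pair_comm (latQ b) (latQ a)]
        ring
      neg_mem' := by
        rintro a ⟨m, hm⟩
        obtain ⟨p, hp⟩ := hLL a a
        refine ⟨-m - p, ?_⟩
        push_cast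
        rw [← hm, ← hp, latQ_neg]
        simp only [pair_neg_left, pair_add_right]
        rw [Γ.pair_comm (latQ a) (-latQ a), pair_neg_left]
        ring }
  have hE : ∀ i, indicatorE {i} ∈ S := by
    intro i
    obtain ⟨m, hm⟩ := (Γ.leastRep h).2 (indicatorE {i})
    refine ⟨1 - m, ?_⟩
    have h1 : Γ.pair (latQ (indicatorE {i})) (latQ (indicatorE {i})) = (Γ.euler i : ℚ) := by
      rw [pair_E, latQ_indicatorE_singleton, Matrix.mulVec_single_one]
      simp [matQ, intersectionMatrix]
    rw [pair_add_right, h1, Γ.pair_comm _ (Γ.kh h), kh, pair_add_left, pair_neg_left, adjunction,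
      pair_smul_left, hm]
    push_cast
    ring
  have hl : l = ∑ i, l i • indicatorE ({i} : Finset V) := by
    ext j
    simp [indicatorE, Finset.sum_apply]
  have : l ∈ S := by
    rw [hl]
    exact S.sum_mem fun i _ => S.zsmul_mem (hE i) _
  exact this

lemma exists_chi_ge (h : Γ.H) : ∃ m : ℤ, ∀ l, m ≤ Γ.chi h l := by
  refine ⟨⌊Γ.pair (Γ.kh h) (Γ.kh h) / 8⌋, fun l => Int.floor_le_floor ?_⟩
  have := Γ.pair_self_nonpos (latQ l + (1 / 2 : ℚ) • Γ.kh h)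
  have e1 : Γ.pair (latQ l) ((1 / 2 : ℚ) • Γ.kh h) = 1 / 2 * Γ.pair (latQ l) (Γ.kh h) := by
    rw [Γ.pair_comm, pair_smul_left, Γ.pair_comm]
  have e2 : Γ.pair (Γ.kh h) ((1 / 2 : ℚ) • Γ.kh h) = 1 / 2 * Γ.pair (Γ.kh h) (Γ.kh h) := by
    rw [Γ.pair_comm, pair_smul_left]
  simp only [pair_add_left, pair_add_right, pair_smul_left, e1, e2,
    Γ.pair_comm (Γ.kh h) (latQ l)] at this
  rw [pair_add_right]
  linarith

end Lattice

end ResolutionGraph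

/-! ### Cubes and the homology of pairs of cubical subspaces of `ℝ^V` -/

/-- The cube `(l, I)` of `ℝ^V`, of dimension `|I|`, with vertices `l + E_J`, `J ⊆ I`. -/
@[ext]
structure LatticeCube (V : Type*) where
  base : V → ℤ
  dirs : Finset V

namespace LatticeCube

variable {V : Type*}

/-- The closed cube as a subset of `ℝ^V`. -/
def toSet [DecidableEq V] (c : LatticeCube V) : Set (V → ℝ) :=
  {x | ∀ i, (c.base i : ℝ) ≤ x i ∧ x i ≤ (c.base i : ℝ) + (if i ∈ c.dirs then 1 else 0)}

/-- The face `(l, I \ i)`. -/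
def backFace [DecidableEq V] (c : LatticeCube V) (i : V) : LatticeCube V :=
  ⟨c.base, c.dirs.erase i⟩

/-- The face `(l + E_i, I \ i)`. -/
def frontFace [DecidableEq V] (c : LatticeCube V) (i : V) : LatticeCube V :=
  ⟨c.base + indicatorE {i}, c.dirs.erase i⟩

/-- The cellular boundary operator of the cubical decomposition of `ℝ^V`:
if `I = {i_1 < ⋯ < i_q}` then
`∂ (l, I) = ∑_k (-1)^(k-1) ((l + E_{i_k}, I \ i_k) - (l, I \ i_k))`. -/
noncomputable def boundary (V : Type*) [LinearOrder V] :
    (LatticeCube V →₀ ℤ) →ₗ[ℤ] (LatticeCube V →₀ ℤ) :=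
  Finsupp.lsum ℤ fun c => LinearMap.toSpanSingleton ℤ (LatticeCube V →₀ ℤ)
    (∑ i ∈ c.dirs, (-1 : ℤ) ^ (c.dirs.filter (· < i)).card •
      (Finsupp.single (c.frontFace i) 1 - Finsupp.single (c.backFace i) 1))

/-- The cubical chains `C_b(A)` of a union of cubes `A ⊆ ℝ^V`: the free `ℤ`-module generated by the
`b`-dimensional cubes contained in `A`. -/
def chains [DecidableEq V] (A : Set (V → ℝ)) (b : ℕ) : Submodule ℤ (LatticeCube V →₀ ℤ) :=
  Finsupp.supported ℤ ℤ {c | c.dirs.card = b ∧ c.toSet ⊆ A}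

/-- Relative cycles of the pair `(A, B)`: chains of `A` in degree `b` with boundary in `B`. -/
noncomputable def relCycles [LinearOrder V] (A B : Set (V → ℝ)) (b : ℕ) :
    Submodule ℤ (LatticeCube V →₀ ℤ) :=
  chains A b ⊓ (Finsupp.supported ℤ ℤ {c | c.toSet ⊆ B}).comap (boundary V)

/-- Relative boundaries of the pair `(A, B)`: `C_b(B) + ∂ C_{b+1}(A)`. -/
noncomputable def relBoundaries [LinearOrder V] (A B : Set (V → ℝ)) (b : ℕ) :
    Submodule ℤ (LatticeCube V →₀ ℤ) :=
  chains B b ⊔ (chains A (b + 1)).map (boundary V)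

/-- The homology `H_b(A, B; ℤ)` of a pair `B ⊆ A` of unions of cubes of `ℝ^V`, computed by the
cellular chain complex of the cubical decomposition. -/
abbrev RelHomology [LinearOrder V] (A B : Set (V → ℝ)) (b : ℕ) : Type _ :=
  relCycles A B b ⧸ (relBoundaries A B b).submoduleOf (relCycles A B b)

/-- The `ℤ`-rank of `H_b(A, B; ℤ)`. -/
noncomputable def relBetti [LinearOrder V] (A B : Set (V → ℝ)) (b : ℕ) : ℕ :=
  Module.finrank ℤ (RelHomology A B b)

lemma toSet_nonempty [DecidableEq V] (c : LatticeCube V) : c.toSet.Nonempty :=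
  ⟨fun i => c.base i, fun i => ⟨le_refl _, by split_ifs <;> simp⟩⟩

lemma relBetti_empty [LinearOrder V] (B : Set (V → ℝ)) (b : ℕ) : relBetti ∅ B b = 0 := by
  have h0 : chains (∅ : Set (V → ℝ)) b = ⊥ := by
    have : {c : LatticeCube V | c.dirs.card = b ∧ c.toSet ⊆ ∅} = ∅ := by
      ext c
      refine ⟨fun hc => ?_, fun hc => hc.elim⟩
      exact c.toSet_nonempty.ne_empty (Set.subset_empty_iff.mp hc.2)
    rw [chains, this, Finsupp.supported_empty]
  have h1 : relCycles (∅ : Set (V → ℝ)) B b = ⊥ := by rw [relCycles, h0, bot_inf_eq]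
  have : Subsingleton (relCycles (∅ : Set (V → ℝ)) B b) := by rw [h1]; infer_instance
  have : Subsingleton (RelHomology (∅ : Set (V → ℝ)) B b) :=
    (Submodule.Quotient.mk_surjective _).subsingleton
  exact Module.finrank_zero_of_subsingleton

end LatticeCube

/-! ### Formal series

`HahnSeries (ℤ × ℤ) R` is the ring `R[[T, Q]][T⁻¹, Q⁻¹]`, and more generally for finite `σ`
`HahnSeries ((σ → ℤ) × ℤ) R` is the ring of Laurent series (with exponents bounded below)
in the variables `T_i` (`i ∈ σ`) and `Q`; the last exponent is that of `Q`. -/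

namespace FormalSeries

variable {G : Type*} [AddCommGroup G] [PartialOrder G] [IsOrderedAddMonoid G]

/-- The variable `Q`. -/
noncomputable def Q (G : Type*) [AddCommGroup G] [PartialOrder G] : HahnSeries (G × ℤ) ℤ :=
  HahnSeries.single (0, 1) 1

/-- The series `1 / (1 - Q)`. -/
noncomputable def invOneSubQ (G : Type*) [AddCommGroup G] [PartialOrder G] [IsOrderedAddMonoid G] :
    HahnSeries (G × ℤ) ℤ := Ring.inverse (1 - Q G)

lemma isUnit_one_sub_Q : IsUnit (1 - Q G) := by
  let f : ℕ →+ G × ℤ :=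
    { toFun := fun k => (0, (k : ℤ)), map_zero' := by simp, map_add' := by intros; simp }
  have hf : Function.Injective f := fun a b hab => by
    simpa [f] using hab
  have hf' : ∀ a b : ℕ, f a ≤ f b ↔ a ≤ b := fun a b => by
    simp [f, Prod.le_def]
  let F := (HahnSeries.embDomainRingHom (R := ℤ) f hf hf').comp
    ((HahnSeries.toPowerSeries (R := ℤ)).symm : PowerSeries ℤ →+* HahnSeries ℕ ℤ)
  have hu : IsUnit (1 - PowerSeries.X : PowerSeries ℤ) := by
    rw [PowerSeries.isUnit_iff_constantCoeff]; simp
  have hX : F PowerSeries.X = Q G := by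
    have : (HahnSeries.toPowerSeries (R := ℤ)).symm PowerSeries.X = HahnSeries.single 1 1 := by
      rw [RingEquiv.symm_apply_eq]
      ext n
      simp [PowerSeries.coeff_X, HahnSeries.coeff_single]
    change HahnSeries.embDomain _ ((HahnSeries.toPowerSeries (R := ℤ)).symm PowerSeries.X) = _
    rw [this, HahnSeries.embDomain_single]
    simp [Q, f]
  have := hu.map F
  rwa [map_sub, map_one, hX] at this

/-- The formal sum `∑ₐ f a` is defined (every monomial occurs in finitely many `f a`, and
exponents are uniformly bounded below) and equals `S`. -/
def HasFormalSum {α G R : Type*} [PartialOrder G] [AddCommMonoid R] (f : α → HahnSeries G R)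
    (S : HahnSeries G R) : Prop :=
  ∃ F : HahnSeries.SummableFamily G R α, (∀ a, F a = f a) ∧ F.hsum = S

lemma isPWO_Ici_int (a : ℤ) : (Set.Ici a).IsPWO := by
  have : Set.Ici a = (fun n : ℕ => a + (n : ℤ)) '' Set.univ := by
    ext z
    simp only [Set.mem_Ici, Set.image_univ, Set.mem_range]
    exact ⟨fun hz => ⟨(z - a).toNat, by omega⟩, by rintro ⟨n, rfl⟩; omega⟩
  rw [this]
  exact (Set.isPWO_of_wellQuasiOrderedLE _).image_of_monotone fun m n hmn => by
    simpa using hmn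

end FormalSeries

/-! ### The filtered lattice homology and its first page -/

namespace ResolutionGraph

section Filtration

variable {V : Type*} [Fintype V] [LinearOrder V] (Γ : ResolutionGraph V)

/-- The weight `w_h(l, I) = max {χ_h(l + E_J) : J ⊆ I}` of a cube. -/
noncomputable def weight (h : Γ.H) (c : LatticeCube V) : ℤ :=
  c.dirs.powerset.sup' (Finset.powerset_nonempty _) fun J => Γ.chi h (c.base + indicatorE J)

/-- The sublevel space `S_n`, the union of all cubes of weight at most `n`. -/
def sublevel (h : Γ.H) (n : ℤ) : Set (V → ℝ) :=
  ⋃ (c : LatticeCube V) (_ : Γ.weight h c ≤ n), c.toSet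

/-- `d(l) = -(s, l)`. -/
noncomputable def deg (s : Γ.dualLattice) (l : V → ℤ) : ℤ := -Γ.dualPair s l

/-- The first quadrant `𝔛 = (ℝ_{≥ 0})^V`. -/
def quadrant (_Γ : ResolutionGraph V) : Set (V → ℝ) := {x | ∀ i, 0 ≤ x i}

/-- `𝔛_{-d}`, the union of the cubes `(l, I)` with `l ∈ L_{≥ 0}` and `(s, l) ≤ -d`. -/
def level (s : Γ.dualLattice) (d : ℤ) : Set (V → ℝ) :=
  ⋃ (c : LatticeCube V) (_ : 0 ≤ c.base ∧ Γ.dualPair s c.base ≤ -d), c.toSet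

/-- The coefficients `n_i = -(s, E_i)` in `s = ∑ n_i E_i^*`. -/
noncomputable def mult (s : Γ.dualLattice) (i : V) : ℤ := -Γ.dualPair s (indicatorE {i})

/-- `Supp(s) = {i : (s, E_i) < 0}`. -/
noncomputable def supp (s : Γ.dualLattice) : Finset V :=
  Finset.univ.filter fun i => Γ.dualPair s (indicatorE {i}) < 0

/-- The embedding of `L_{Supp(s), ≥ 0}` in `L`. -/
noncomputable def extendSupp (s : Γ.dualLattice) (k : Γ.supp s → ℕ) : V → ℤ :=
  fun i => if hi : i ∈ Γ.supp s then (k ⟨i, hi⟩ : ℤ) else 0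

/-- `𝔛_{-k} = ∏_{i ∈ Supp(s)} [k_i, ∞) × ∏_{i ∉ Supp(s)} [0, ∞)`. -/
def multiLevel (s : Γ.dualLattice) (k : Γ.supp s → ℕ) : Set (V → ℝ) :=
  {x | ∀ i, (Γ.extendSupp s k i : ℝ) ≤ x i}

/-- The rank of `(E^1_{-d,q})_n = H_b(S_n ∩ 𝔛_{-d}, S_n ∩ 𝔛_{-d-1}; ℤ)`, `b = -d + q`. -/
noncomputable def rankE1 (h : Γ.H) (s : Γ.dualLattice) (d n : ℤ) (b : ℕ) : ℕ :=
  LatticeCube.relBetti (Γ.sublevel h n ∩ Γ.level s d) (Γ.sublevel h n ∩ Γ.level s (d + 1)) b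

/-- The rank of
`(E^1_{-k,q})_n = H_b(S_n ∩ 𝔛_{-k}, S_n ∩ 𝔛_{-k} ∩ 𝔛_{-d(k)-1}; ℤ)`, `b = -d(k) + q`. -/
noncomputable def rankMultiE1 (h : Γ.H) (s : Γ.dualLattice) (k : Γ.supp s → ℕ) (n : ℤ) (b : ℕ) :
    ℕ :=
  LatticeCube.relBetti (Γ.sublevel h n ∩ Γ.multiLevel s k)
    (Γ.sublevel h n ∩ Γ.multiLevel s k ∩ Γ.level s (Γ.deg s (Γ.extendSupp s k) + 1)) b

lemma exists_sublevel_eq_empty (h : Γ.H) : ∃ m : ℤ, ∀ n < m, Γ.sublevel h n = ∅ := by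
  obtain ⟨m, hm⟩ := Γ.exists_chi_ge h
  refine ⟨m, fun n hn => ?_⟩
  simp only [sublevel, Set.iUnion_eq_empty]
  intro c hc
  exfalso
  have : Γ.chi h (c.base + indicatorE ∅) ≤ Γ.weight h c :=
    Finset.le_sup' (fun J => Γ.chi h (c.base + indicatorE J)) (Finset.empty_mem_powerset _)
  have := hm (c.base + indicatorE ∅)
  omega

/-- The series `PE_1(T, Q, 𝔥) = ∑_{d, n, b} rank H_b(S_n ∩ 𝔛_{-d}, S_n ∩ 𝔛_{-d-1}; ℤ) T^d Q^n 𝔥^b`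
(`d ≥ 0`; no homology beyond degree `|V|`), with coefficients in `ℤ[𝔥]`. -/
noncomputable def PE1 (h : Γ.H) (s : Γ.dualLattice) : HahnSeries (ℤ × ℤ) (Polynomial ℤ) where
  coeff := fun g => if 0 ≤ g.1 then
    ∑ b ∈ Finset.range (Fintype.card V + 1), Polynomial.monomial b (Γ.rankE1 h s g.1 g.2 b : ℤ)
    else 0
  isPWO_support' := by
    obtain ⟨m, hm⟩ := Γ.exists_sublevel_eq_empty h
    refine ((FormalSeries.isPWO_Ici_int 0).prod (FormalSeries.isPWO_Ici_int m)).mono ?_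
    rintro ⟨d, n⟩ hg
    rw [Function.mem_support] at hg
    by_cases hd : 0 ≤ d
    · refine ⟨hd, ?_⟩
      by_contra hn
      apply hg
      have hS := hm n (not_le.mp hn)
      simp [rankE1, hS, LatticeCube.relBetti_empty]
    · exact absurd (if_neg hd) hg

/-- The multivariable series `∑_{k, n, b} rank (E^1_{-k,q})_n (∏_{i ∈ Supp(s)} T_i^{n_i k_i}) Q^n 𝔥^b`,
where `k` runs over `(ℤ_{≥ 0})^{Supp(s)}` and `b = -d(k) + q`, with coefficients in `ℤ[𝔥]`. -/
noncomputable def multiPE1 (h : Γ.H) (s : Γ.dualLattice) :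
    HahnSeries ((Γ.supp s → ℤ) × ℤ) (Polynomial ℤ) where
  coeff := fun g => ∑ᶠ (k : Γ.supp s → ℕ) (_ : ∀ i, g.1 i = Γ.mult s i * k i),
    ∑ b ∈ Finset.range (Fintype.card V + 1), Polynomial.monomial b (Γ.rankMultiE1 h s k g.2 b : ℤ)
  isPWO_support' := by
    obtain ⟨m, hm⟩ := Γ.exists_sublevel_eq_empty h
    refine ((Set.IsPWO.pi (s := fun _ : Γ.supp s => Set.Ici (0 : ℤ))
      (fun _ => FormalSeries.isPWO_Ici_int 0)).prod (FormalSeries.isPWO_Ici_int m)).mono ?_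
    rintro ⟨e, n⟩ hg
    rw [Function.mem_support] at hg
    obtain ⟨k, hk⟩ : ∃ k : Γ.supp s → ℕ, (∑ᶠ (_ : ∀ i, e i = Γ.mult s i * k i),
        ∑ b ∈ Finset.range (Fintype.card V + 1),
          Polynomial.monomial b (Γ.rankMultiE1 h s k n b : ℤ)) ≠ 0 := by
      by_contra hall
      push Not at hall
      exact hg (by simp only [hall, finsum_zero])
    have hek : ∀ i, e i = Γ.mult s i * k i := by
      by_contra hek
      exact hk (by rw [finsum_eq_if, if_neg hek])
    rw [finsum_eq_if, if_pos hek] at hk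
    refine ⟨fun i _ => ?_, ?_⟩
    · have h1 : 0 ≤ Γ.mult s i := by
        have := (Finset.mem_filter.mp i.2).2
        simp only [mult]
        omega
      change 0 ≤ e i
      rw [hek i]
      positivity
    · by_contra hn
      apply hk
      have hS := hm n (not_le.mp hn)
      simp [rankMultiE1, hS, LatticeCube.relBetti_empty]

/-- `∑_{I ⊆ V} (-1)^{|I|} Q^{w_h(l, I)}`. -/
noncomputable def cubeSum (G : Type*) [AddCommGroup G] [PartialOrder G] (h : Γ.H) (l : V → ℤ) :
    HahnSeries (G × ℤ) ℤ :=
  ∑ I : Finset V, (-1 : ℤ) ^ I.card • HahnSeries.single (0, Γ.weight h ⟨l, I⟩) (1 : ℤ)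

/-- The monomial `T^{d(l)} = T^{-(s, l)}`. -/
noncomputable def monT (s : Γ.dualLattice) (l : V → ℤ) : HahnSeries (ℤ × ℤ) ℤ :=
  HahnSeries.single (Γ.deg s l, 0) 1

/-- The monomial `∏_{i ∈ Supp(s)} T_i^{n_i l_i}`. -/
noncomputable def monMultiT (s : Γ.dualLattice) (l : V → ℤ) :
    HahnSeries ((Γ.supp s → ℤ) × ℤ) ℤ :=
  HahnSeries.single (fun i : Γ.supp s => Γ.mult s i * l i, 0) 1

end Filtration

end ResolutionGraph

/-! At `𝔥 = -1` the coefficient of `T^d Q^n` in `PE_1` is the Euler characteristic of the pair `(S_n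
∩ 𝔛_{-d}, S_n ∩ 𝔛_{-d-1})`. Negative definiteness makes `S_n` a finite complex (`finite_weight_le`),
so this is the signed count of the cubes in the first space but not in the second (`sum_relBetti`).
Those are the cubes `(l, I)` with `l ≥ 0`, `d(l) = d` and weight at most `n`
(`toSet_subset_sublevel_iff`, `toSet_subset_level_iff`). Multiplication by `1 - Q` replaces "weight
at most `n`" by "weight exactly `n`", which gives the sum over cubes; grouping the cubes by base
point gives the sum over `l ≥ 0`.

The multivariable case is the same count graded by `(n_i l_i)_i`: for `l ≥ k` on the support, `d(l)
= d(k)` forces `l_i = k_i` there (`deg_le_deg_extendSupp_iff`).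

A point `l` that is not effective contributes nothing. By minimality of `s_h` some `i` has `(l +
s_h, E_i) ≥ 1`; then moving along `E_i` never raises `χ_h` on the cubes based at `l`, so `I` and `I
∪ {i}` have equal weight and cancel (`exists_weight_insert_eq`, `cubeSum_eq_zero`). -/

/-! ### Ranks of submodules. -/

theorem LinearMap.finrank_map_add_finrank_inf_ker {R M N : Type*} [CommRing R] [IsDomain R]
    [AddCommGroup M] [Module R M] [AddCommGroup N] [Module R N] (f : M →ₗ[R] N)
    (P : Submodule R M) [Module.Finite R P] :
    Module.finrank R (P.map f) + Module.finrank R (P ⊓ LinearMap.ker f : Submodule R M) =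
      Module.finrank R P := by
  rw [← Submodule.finrank_quotient_add_finrank (LinearMap.ker (f.domRestrict P)),
    (f.domRestrict P).quotKerEquivRange.finrank_eq, LinearMap.range_domRestrict,
    LinearMap.ker_domRestrict, ← Submodule.map_comap_subtype,
    (Submodule.equivMapOfInjective P.subtype P.injective_subtype _).finrank_eq.symm]

theorem Finsupp.finrank_supported {R α : Type*} [Ring R] [StrongRankCondition R] (s : Set α) :
    Module.finrank R (Finsupp.supported R R s) = s.ncard := by
  rw [(Finsupp.supportedEquivFinsupp s).finrank_eq]
  by_cases hs : s.Finite
  · have := hs.fintype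
    rw [Module.finrank_finsupp_self, ← Nat.card_eq_fintype_card, Nat.card_coe_set_eq]
  -- For infinite `s` both sides take the default value `0`.
  · rw [Set.Infinite.ncard hs, Module.finrank, rank_finsupp_self]
    have : Infinite s := Set.infinite_coe_iff.mpr hs
    simp

/-! ### The cubical chain complex and the Euler characteristic of a pair. -/

namespace LatticeCube

variable {V : Type*} [LinearOrder V]

theorem boundary_single (c : LatticeCube V) :
    boundary V (Finsupp.single c 1) = ∑ i ∈ c.dirs, (-1 : ℤ) ^ (c.dirs.filter (· < i)).card •
      (Finsupp.single (c.frontFace i) 1 - Finsupp.single (c.backFace i) 1) := by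
  simp [boundary]

theorem frontFace_subset (c : LatticeCube V) {i : V} (hi : i ∈ c.dirs) :
    (c.frontFace i).toSet ⊆ c.toSet := by
  intro x hx j
  have := hx j
  rcases eq_or_ne j i with rfl | hj
  · simp [frontFace, indicatorE] at this
    simp [hi]
    constructor <;> linarith
  · simpa [frontFace, indicatorE, hj] using this

theorem backFace_subset (c : LatticeCube V) {i : V} (hi : i ∈ c.dirs) :
    (c.backFace i).toSet ⊆ c.toSet := by
  intro x hx j
  have := hx j
  rcases eq_or_ne j i with rfl | hj
  · simp [backFace] at this
    simp [hi]
    constructor <;> linarith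
  · simpa [backFace, hj] using this

/-- Deleting `i < j` shifts the position of `j` by one, while deleting `j` leaves that of `i` alone.
This antisymmetry is what makes `∂² = 0`. -/
theorem sign_erase_mul_sign (I : Finset V) {i j : V} (hi : i ∈ I) (hij : i < j) :
    (-1 : ℤ) ^ (I.filter (· < i)).card * (-1) ^ ((I.erase i).filter (· < j)).card =
      -((-1) ^ (I.filter (· < j)).card * (-1) ^ ((I.erase j).filter (· < i)).card) := by
  have h1 : (I.erase j).filter (· < i) = I.filter (· < i) := by
    ext x
    simp only [Finset.mem_filter, Finset.mem_erase]
    exact ⟨fun h => ⟨h.1.2, h.2⟩, fun h => ⟨⟨(h.2.trans hij).ne, h.1⟩, h.2⟩⟩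
  have h2 : (I.filter (· < j)).card = ((I.erase i).filter (· < j)).card + 1 := by
    rw [Finset.filter_erase, Finset.card_erase_add_one (by simp [hi, hij])]
  rw [h1, h2]
  ring

/-- The difference of the opposite faces in the direction `i`. -/
noncomputable def faceDiff (c : LatticeCube V) (i : V) : LatticeCube V →₀ ℤ :=
  Finsupp.single (c.frontFace i) 1 - Finsupp.single (c.backFace i) 1

theorem boundary_faceDiff (c : LatticeCube V) (i : V) :
    boundary V (c.faceDiff i) = ∑ j ∈ c.dirs.erase i,
      (-1 : ℤ) ^ ((c.dirs.erase i).filter (· < j)).card •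
        ((c.frontFace i).faceDiff j - (c.backFace i).faceDiff j) := by
  rw [faceDiff, map_sub, boundary_single, boundary_single]
  exact (Finset.sum_sub_distrib _ _).symm.trans
    (Finset.sum_congr rfl fun j _ => (smul_sub _ _ _).symm)

/-- Both sides are the same signed sum of the four faces with directions `i` and `j` removed. -/
theorem faceDiff_comm (c : LatticeCube V) (i j : V) :
    (c.frontFace i).faceDiff j - (c.backFace i).faceDiff j =
      (c.frontFace j).faceDiff i - (c.backFace j).faceDiff i := by
  simp only [faceDiff, frontFace, backFace]
  rw [Finset.erase_right_comm, add_right_comm]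
  abel

theorem boundary_boundary (x : LatticeCube V →₀ ℤ) : boundary V (boundary V x) = 0 := by
  suffices h : (boundary V).comp (boundary V) = 0 from LinearMap.congr_fun h x
  refine Finsupp.lhom_ext' fun c => LinearMap.ext_ring ?_
  simp only [LinearMap.comp_apply, Finsupp.lsingle_apply, LinearMap.zero_apply]
  rw [boundary_single, map_sum]
  have h1 : ∀ i ∈ c.dirs, boundary V ((-1 : ℤ) ^ (c.dirs.filter (· < i)).card •
      (Finsupp.single (c.frontFace i) 1 - Finsupp.single (c.backFace i) 1)) =
      ∑ j ∈ c.dirs.erase i, ((-1 : ℤ) ^ (c.dirs.filter (· < i)).card *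
        (-1) ^ ((c.dirs.erase i).filter (· < j)).card) •
        ((c.frontFace i).faceDiff j - (c.backFace i).faceDiff j) := by
    intro i _
    rw [map_smul, ← faceDiff, boundary_faceDiff, Finset.smul_sum]
    simp only [mul_smul]
  rw [Finset.sum_congr rfl h1, Finset.sum_sigma']
  -- The terms for `(i, j)` and `(j, i)` carry the same chain with opposite signs.
  refine Finset.sum_involution (fun p _ => ⟨p.2, p.1⟩) ?_ ?_ ?_ ?_
  · rintro ⟨i, j⟩ hp
    simp only [Finset.mem_sigma, Finset.mem_erase] at hp
    rw [c.faceDiff_comm j i, ← add_smul]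
    rcases lt_or_gt_of_ne hp.2.1 with h | h
    · rw [sign_erase_mul_sign _ hp.2.2 h]; simp
    · rw [sign_erase_mul_sign _ hp.1 h]; simp
  · rintro ⟨i, j⟩ hp _ h
    simp only [Finset.mem_sigma, Finset.mem_erase] at hp
    exact hp.2.1 (congrArg Sigma.fst h)
  · rintro ⟨i, j⟩ hp
    simp only [Finset.mem_sigma, Finset.mem_erase] at hp ⊢
    exact ⟨hp.2.2, hp.2.1.symm, hp.1⟩
  · rintro ⟨i, j⟩ _
    rfl

theorem boundary_mem_chains {A : Set (V → ℝ)} {b : ℕ} {x : LatticeCube V →₀ ℤ}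
    (hx : x ∈ chains A (b + 1)) : boundary V x ∈ chains A b := by
  suffices h : chains A (b + 1) ≤ (chains A b).comap (boundary V) from h hx
  rw [chains, Finsupp.supported_eq_span_single, Submodule.span_le]
  rintro _ ⟨c, hc, rfl⟩
  rw [SetLike.mem_coe, Submodule.mem_comap, boundary_single]
  refine Submodule.sum_mem _ fun i hi => Submodule.smul_mem _ _ (Submodule.sub_mem _ ?_ ?_)
  · refine Finsupp.single_mem_supported _ _ ⟨?_, (c.frontFace_subset hi).trans hc.2⟩
    simp [frontFace, Finset.card_erase_of_mem hi, hc.1]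
  · refine Finsupp.single_mem_supported _ _ ⟨?_, (c.backFace_subset hi).trans hc.2⟩
    simp [backFace, Finset.card_erase_of_mem hi, hc.1]

theorem boundary_of_mem_chains_zero {A : Set (V → ℝ)} {x : LatticeCube V →₀ ℤ}
    (hx : x ∈ chains A 0) : boundary V x = 0 := by
  suffices h : chains A 0 ≤ LinearMap.ker (boundary V) from h hx
  rw [chains, Finsupp.supported_eq_span_single, Submodule.span_le]
  rintro _ ⟨c, hc, rfl⟩
  rw [SetLike.mem_coe, LinearMap.mem_ker, boundary_single, Finset.card_eq_zero.mp hc.1,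
    Finset.sum_empty]

/-- All chains of `B`, in all degrees. -/
noncomputable abbrev allChains (B : Set (V → ℝ)) : Submodule ℤ (LatticeCube V →₀ ℤ) :=
  Finsupp.supported ℤ ℤ {c | c.toSet ⊆ B}

theorem chains_le_allChains (B : Set (V → ℝ)) (b : ℕ) : chains B b ≤ allChains B :=
  Finsupp.supported_mono fun _ hc => hc.2

theorem chains_mono {A B : Set (V → ℝ)} (hBA : B ⊆ A) (b : ℕ) : chains B b ≤ chains A b :=
  Finsupp.supported_mono fun _ hc => ⟨hc.1, hc.2.trans hBA⟩

theorem chains_inf_allChains {A B : Set (V → ℝ)} (hBA : B ⊆ A) (b : ℕ) :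
    chains A b ⊓ allChains B = chains B b := by
  rw [chains, chains, allChains, ← Finsupp.supported_inter]
  congr 1
  ext c
  exact ⟨fun h => ⟨h.1.1, h.2⟩, fun h => ⟨⟨h.1, h.2.trans hBA⟩, h.2⟩⟩

theorem boundary_mem_allChains {B : Set (V → ℝ)} {b : ℕ} {x : LatticeCube V →₀ ℤ}
    (hx : x ∈ chains B b) : boundary V x ∈ allChains B := by
  cases b with
  | zero => rw [boundary_of_mem_chains_zero hx]; exact zero_mem _
  | succ b => exact chains_le_allChains B b (boundary_mem_chains hx)

theorem relBoundaries_le_chains {A B : Set (V → ℝ)} (hBA : B ⊆ A) (b : ℕ) :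
    relBoundaries A B b ≤ chains A b := by
  refine sup_le (chains_mono hBA b) ?_
  rintro _ ⟨x, hx, rfl⟩
  exact boundary_mem_chains hx

theorem relBoundaries_le_relCycles {A B : Set (V → ℝ)} (hBA : B ⊆ A) (b : ℕ) :
    relBoundaries A B b ≤ relCycles A B b := by
  refine le_inf (relBoundaries_le_chains hBA b) (sup_le ?_ ?_)
  · exact fun x hx => boundary_mem_allChains hx
  · rintro _ ⟨x, hx, rfl⟩
    rw [Submodule.mem_comap, boundary_boundary]
    exact zero_mem _

/-- The rank of the relative boundary map `C_b(A) → C(V) / C(B)`. -/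
noncomputable def boundaryRank (A B : Set (V → ℝ)) (b : ℕ) : ℕ :=
  Module.finrank ℤ ((chains A b).map ((allChains B).mkQ.comp (boundary V)))

theorem chains_finite {A : Set (V → ℝ)} (hA : {c : LatticeCube V | c.toSet ⊆ A}.Finite) (b : ℕ) :
    Module.Finite ℤ (chains A b) := by
  have : Finite {c : LatticeCube V | c.dirs.card = b ∧ c.toSet ⊆ A} :=
    (hA.subset fun _ hc => hc.2).to_subtype
  exact Module.Finite.equiv (Finsupp.supportedEquivFinsupp (R := ℤ) (M := ℤ)
    {c : LatticeCube V | c.dirs.card = b ∧ c.toSet ⊆ A}).symm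

/-- Rank-nullity: relative cycles are the kernel on `C_b(A)` of `∂` taken modulo the chains of `B`.
-/
theorem finrank_relCycles {A B : Set (V → ℝ)}
    (hA : {c : LatticeCube V | c.toSet ⊆ A}.Finite) (b : ℕ) :
    boundaryRank A B b + Module.finrank ℤ (relCycles A B b) = Module.finrank ℤ (chains A b) := by
  have := chains_finite hA b
  rw [← LinearMap.finrank_map_add_finrank_inf_ker ((allChains B).mkQ.comp (boundary V))
    (chains A b), LinearMap.ker_comp, Submodule.ker_mkQ]
  rfl

/-- Rank-nullity for the projection modulo the chains of `B`: on `C_b(B) + ∂ C_{b+1}(A)` its kernel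
is `C_b(B)` and its image is that of `∂ C_{b+1}(A)`. -/
theorem finrank_relBoundaries {A B : Set (V → ℝ)} (hBA : B ⊆ A)
    (hA : {c : LatticeCube V | c.toSet ⊆ A}.Finite) (b : ℕ) :
    boundaryRank A B (b + 1) + Module.finrank ℤ (chains B b) =
      Module.finrank ℤ (relBoundaries A B b) := by
  have := chains_finite hA b
  have : Module.Finite ℤ (relBoundaries A B b) :=
    Module.Finite.of_injective _
      (Submodule.inclusion_injective (relBoundaries_le_chains hBA b))
  rw [← LinearMap.finrank_map_add_finrank_inf_ker (allChains B).mkQ (relBoundaries A B b),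
    Submodule.ker_mkQ]
  have h1 : relBoundaries A B b ⊓ allChains B = chains B b := by
    refine le_antisymm ?_ (le_inf le_sup_left (chains_le_allChains B b))
    rw [← chains_inf_allChains hBA b]
    exact inf_le_inf_right _ (relBoundaries_le_chains hBA b)
  have h2 : (chains B b).map (allChains B).mkQ = ⊥ := by
    rw [← le_bot_iff, Submodule.map_le_iff_le_comap, Submodule.comap_bot, Submodule.ker_mkQ]
    exact chains_le_allChains B b
  rw [h1, relBoundaries, Submodule.map_sup, h2, bot_sup_eq, boundaryRank, Submodule.map_comp]

theorem relBetti_add {A B : Set (V → ℝ)} (hBA : B ⊆ A)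
    (hA : {c : LatticeCube V | c.toSet ⊆ A}.Finite) (b : ℕ) :
    relBetti A B b + boundaryRank A B b + boundaryRank A B (b + 1) +
      Module.finrank ℤ (chains B b) = Module.finrank ℤ (chains A b) := by
  have := chains_finite hA b
  have : Module.Finite ℤ (relCycles A B b) := Module.Finite.of_injective _
    (Submodule.inclusion_injective (inf_le_left : relCycles A B b ≤ chains A b))
  have h1 := Submodule.finrank_quotient_add_finrank
    ((relBoundaries A B b).submoduleOf (relCycles A B b))
  rw [(Submodule.submoduleOfEquivOfLe (relBoundaries_le_relCycles hBA b)).finrank_eq] at h1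
  have h2 := finrank_relCycles (B := B) hA b
  have h3 := finrank_relBoundaries hBA hA b
  change relBetti A B b + _ = _ at h1
  omega

theorem boundaryRank_zero (A B : Set (V → ℝ)) : boundaryRank A B 0 = 0 := by
  have : (chains A 0).map ((allChains B).mkQ.comp (boundary V)) = ⊥ := by
    rw [← le_bot_iff, Submodule.map_le_iff_le_comap, Submodule.comap_bot]
    intro x hx
    simp [boundary_of_mem_chains_zero hx]
  rw [boundaryRank, this, finrank_bot]

theorem boundaryRank_of_card_lt [Fintype V] (A B : Set (V → ℝ)) {b : ℕ}
    (hb : Fintype.card V < b) : boundaryRank A B b = 0 := by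
  have h0 : chains A b = ⊥ := by
    have : {c : LatticeCube V | c.dirs.card = b ∧ c.toSet ⊆ A} = ∅ := by
      ext c
      refine ⟨fun hc => ?_, fun hc => hc.elim⟩
      have := Finset.card_le_univ c.dirs
      have := hc.1
      omega
    rw [chains, this, Finsupp.supported_empty]
  rw [boundaryRank, h0, Submodule.map_bot, finrank_bot]

open Classical in
/-- The Euler characteristic of a pair of finite cubical complexes counts the cubes of the
difference with signs. -/
theorem sum_relBetti [Fintype V] {A B : Set (V → ℝ)} (hBA : B ⊆ A) (F : Finset (LatticeCube V))
    (hF : ∀ c, c ∈ F ↔ c.toSet ⊆ A) :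
    ∑ b ∈ Finset.range (Fintype.card V + 1), (-1 : ℤ) ^ b * (relBetti A B b : ℤ) =
      ∑ c ∈ F with ¬ c.toSet ⊆ B, (-1 : ℤ) ^ c.dirs.card := by
  have hA : {c : LatticeCube V | c.toSet ⊆ A}.Finite :=
    F.finite_toSet.subset fun c hc => (hF c).2 hc
  -- The boundary ranks telescope in the alternating sum; the end terms vanish because there are no
  -- boundaries out of degree `0` and no cubes above dimension `|V|`.
  have hterm : ∀ b, (-1 : ℤ) ^ b * (relBetti A B b : ℤ) =
      (-1) ^ b * ((Module.finrank ℤ (chains A b) : ℤ) - Module.finrank ℤ (chains B b)) +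
      ((-1) ^ (b + 1) * (boundaryRank A B (b + 1) : ℤ) - (-1) ^ b * (boundaryRank A B b : ℤ)) := by
    intro b
    rw [← relBetti_add hBA hA b]
    push_cast
    ring
  rw [Finset.sum_congr rfl fun b _ => hterm b, Finset.sum_add_distrib,
    Finset.sum_range_sub (fun b => (-1 : ℤ) ^ b * (boundaryRank A B b : ℤ)), boundaryRank_zero,
    boundaryRank_of_card_lt A B (Nat.lt_succ_self _)]
  have hrank : ∀ b, (Module.finrank ℤ (chains A b) : ℤ) - Module.finrank ℤ (chains B b) =
      ((F.filter fun c => ¬ c.toSet ⊆ B).filter fun c => c.dirs.card = b).card := by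
    intro b
    have e1 : {c : LatticeCube V | c.dirs.card = b ∧ c.toSet ⊆ A} =
        (F.filter fun c => c.dirs.card = b : Finset (LatticeCube V)) := by
      ext c; simp [hF, and_comm]
    have e2 : {c : LatticeCube V | c.dirs.card = b ∧ c.toSet ⊆ B} =
        ((F.filter fun c => c.dirs.card = b).filter fun c => c.toSet ⊆ B :
          Finset (LatticeCube V)) := by
      ext c
      simp only [Set.mem_ofPred_eq, Finset.coe_filter, Finset.mem_filter, hF]
      exact ⟨fun h => ⟨⟨h.2.trans hBA, h.1⟩, h.2⟩, fun h => ⟨h.1.2, h.2⟩⟩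
    rw [chains, chains, Finsupp.finrank_supported, Finsupp.finrank_supported, e1, e2,
      Set.ncard_coe_finset, Set.ncard_coe_finset,
      Finset.filter_comm (fun c : LatticeCube V => ¬ c.toSet ⊆ B),
      ← Finset.card_filter_add_card_filter_not (s := F.filter fun c => c.dirs.card = b)
        (fun c => c.toSet ⊆ B)]
    push_cast
    ring
  simp only [hrank]
  rw [← Finset.sum_fiberwise_of_maps_to (s := F.filter fun c => ¬ c.toSet ⊆ B)
    (t := Finset.range (Fintype.card V + 1)) (g := fun c => c.dirs.card)
    fun c _ => Finset.mem_range.2 (Nat.lt_succ_of_le (Finset.card_le_univ _))]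
  simp only [Nat.cast_zero, mul_zero, sub_self, add_zero]
  refine Finset.sum_congr rfl fun b _ => ?_
  rw [Finset.sum_congr rfl fun c hc => by rw [(Finset.mem_filter.1 hc).2], Finset.sum_const,
    nsmul_eq_mul, mul_comm]

end LatticeCube

/-! ### Faces of lattice cubes, detected by barycenters. -/

theorem indicatorE_union_of_disjoint {V : Type*} [DecidableEq V] {K J : Finset V}
    (h : Disjoint K J) : indicatorE (K ∪ J) = indicatorE K + indicatorE J := by
  ext i
  have : i ∈ K → i ∉ J := fun hi => Finset.disjoint_left.1 h hi
  by_cases hK : i ∈ K <;> by_cases hJ : i ∈ J <;> simp_all [indicatorE]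

namespace LatticeCube

variable {V : Type*} [DecidableEq V]

/-- The barycenter of a cube. -/
noncomputable def center (c : LatticeCube V) : V → ℝ :=
  fun i => c.base i + if i ∈ c.dirs then 1 / 2 else 0

theorem center_mem (c : LatticeCube V) : c.center ∈ c.toSet := by
  intro i
  simp only [center]
  split_ifs <;> constructor <;> linarith

theorem base_mem (c : LatticeCube V) : (fun i => (c.base i : ℝ)) ∈ c.toSet := by
  intro i
  split_ifs <;> constructor <;> linarith

theorem base_le_of_center_mem {c c' : LatticeCube V} (h : c.center ∈ c'.toSet) :
    c'.base ≤ c.base := by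
  intro i
  have h1 := (h i).1
  simp only [center] at h1
  have h2 : (c'.base i : ℝ) < c.base i + 1 := by split_ifs at h1 <;> linarith
  have h3 : c'.base i < c.base i + 1 := by exact_mod_cast h2
  exact Int.lt_add_one_iff.1 h3

/-- The barycenter is in the relative interior of `c`, so a lattice cube containing it has `c` as a
face; `K` collects the directions in which the base point has moved. Hence containment of `c` in a
union of cubes can be tested at this one point. -/
theorem eq_face_of_center_mem [Fintype V] {c c' : LatticeCube V} (h : c.center ∈ c'.toSet) :
    ∃ K ⊆ c'.dirs, Disjoint K c.dirs ∧ c.dirs ⊆ c'.dirs ∧ c.base = c'.base + indicatorE K := by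
  have hle := base_le_of_center_mem h
  have hub : ∀ i, (i ∈ c.dirs → i ∈ c'.dirs ∧ c.base i = c'.base i) ∧
      (c.base i ≠ c'.base i → i ∈ c'.dirs ∧ c.base i = c'.base i + 1) := by
    intro i
    have h1 := (h i).2
    simp only [center] at h1
    have h0 : c'.base i ≤ c.base i := hle i
    constructor
    · intro hi
      rw [if_pos hi] at h1
      by_cases hi' : i ∈ c'.dirs
      · rw [if_pos hi'] at h1
        have h2 : (c.base i : ℝ) < c'.base i + 1 := by linarith
        have h3 : c.base i < c'.base i + 1 := by exact_mod_cast h2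
        exact ⟨hi', by omega⟩
      · rw [if_neg hi'] at h1
        have h2 : (c.base i : ℝ) < c'.base i := by linarith
        have h3 : c.base i < c'.base i := by exact_mod_cast h2
        omega
    · intro hne
      by_cases hi' : i ∈ c'.dirs
      · rw [if_pos hi'] at h1
        have h2 : (c.base i : ℝ) ≤ c'.base i + 1 := by split_ifs at h1 <;> linarith
        have h3 : c.base i ≤ c'.base i + 1 := by exact_mod_cast h2
        exact ⟨hi', by omega⟩
      · rw [if_neg hi'] at h1
        have h2 : (c.base i : ℝ) ≤ c'.base i := by split_ifs at h1 <;> linarith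
        have h3 : c.base i ≤ c'.base i := by exact_mod_cast h2
        omega
  refine ⟨Finset.univ.filter fun i => c.base i ≠ c'.base i, ?_, ?_, ?_, ?_⟩
  · intro i hi
    exact ((hub i).2 (Finset.mem_filter.1 hi).2).1
  · rw [Finset.disjoint_left]
    intro i hi hic
    exact (Finset.mem_filter.1 hi).2 ((hub i).1 hic).2
  · exact fun i hi => ((hub i).1 hi).1
  · ext i
    by_cases hi : c.base i = c'.base i
    · simp [indicatorE, hi]
    · simp [indicatorE, ((hub i).2 hi).2]

theorem toSet_subset_Ici_iff (c : LatticeCube V) (l : V → ℤ) :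
    c.toSet ⊆ {x | ∀ i, (l i : ℝ) ≤ x i} ↔ l ≤ c.base := by
  constructor
  · intro h i
    exact_mod_cast h c.base_mem i
  · intro h x hx i
    have : (l i : ℝ) ≤ c.base i := by exact_mod_cast h i
    exact this.trans (hx i).1

end LatticeCube

/-! ### Which cubes lie in the sublevel spaces and in the filtration. -/

namespace ResolutionGraph

variable {V : Type*} [Fintype V] [LinearOrder V] (Γ : ResolutionGraph V)

theorem chi_le_weight (h : Γ.H) (c : LatticeCube V) {J : Finset V} (hJ : J ⊆ c.dirs) :
    Γ.chi h (c.base + indicatorE J) ≤ Γ.weight h c :=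
  Finset.le_sup' (fun J => Γ.chi h (c.base + indicatorE J)) (Finset.mem_powerset.2 hJ)

theorem weight_le_iff (h : Γ.H) (c : LatticeCube V) (n : ℤ) :
    Γ.weight h c ≤ n ↔ ∀ J ⊆ c.dirs, Γ.chi h (c.base + indicatorE J) ≤ n := by
  simp [weight, Finset.sup'_le_iff]

theorem chi_base_le_weight (h : Γ.H) (c : LatticeCube V) : Γ.chi h c.base ≤ Γ.weight h c := by
  have := Γ.chi_le_weight h c (Finset.empty_subset _)
  rwa [show indicatorE (∅ : Finset V) = 0 from by ext; simp [indicatorE], add_zero] at this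

/-- `S_n` is only a point set, so a cube inside it might be covered by several others. The cube
covering its barycenter has it as a face, and passing to a face does not raise the weight. -/
theorem toSet_subset_sublevel_iff (h : Γ.H) (c : LatticeCube V) (n : ℤ) :
    c.toSet ⊆ Γ.sublevel h n ↔ Γ.weight h c ≤ n := by
  constructor
  · intro hc
    obtain ⟨c', hc', hmem⟩ := Set.mem_iUnion₂.1 (hc c.center_mem)
    obtain ⟨K, hK, hdisj, hdirs, hbase⟩ := LatticeCube.eq_face_of_center_mem hmem
    rw [weight_le_iff]
    intro J hJ
    rw [hbase, add_assoc, ← indicatorE_union_of_disjoint (hdisj.mono_right hJ)]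
    exact (Γ.chi_le_weight h c' (Finset.union_subset hK (hJ.trans hdirs))).trans hc'
  · exact fun hc => Set.subset_iUnion₂_of_subset c hc subset_rfl

theorem toSet_subset_quadrant_iff (c : LatticeCube V) :
    c.toSet ⊆ Γ.quadrant ↔ 0 ≤ c.base := by
  rw [← c.toSet_subset_Ici_iff 0]
  simp [quadrant]

theorem toSet_subset_multiLevel_iff (s : Γ.dualLattice) (k : Γ.supp s → ℕ) (c : LatticeCube V) :
    c.toSet ⊆ Γ.multiLevel s k ↔ Γ.extendSupp s k ≤ c.base :=
  c.toSet_subset_Ici_iff _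

theorem deg_eq_sum (s : Γ.dualLattice) (l : V → ℤ) :
    Γ.deg s l = ∑ i, Γ.mult s i * l i := by
  have hpair : ∀ l : V → ℤ, Γ.pair s (latQ l) = ∑ i, Γ.matQ.mulVec s i * l i := by
    intro l
    rw [pair_comm, pair, dotProduct]
    exact Finset.sum_congr rfl fun i _ => mul_comm _ _
  have h : (Γ.deg s l : ℚ) = ((∑ i, Γ.mult s i * l i : ℤ) : ℚ) := by
    rw [deg]
    push_cast
    rw [dualPair_cast, hpair, ← Finset.sum_neg_distrib]
    refine Finset.sum_congr rfl fun i _ => ?_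
    rw [mult]
    push_cast
    rw [dualPair_cast, pair_E]
    ring
  exact_mod_cast h

variable {Γ} in
theorem mult_nonneg {s : Γ.dualLattice} (hs : s ∈ Γ.lipmanCone) (i : V) : 0 ≤ Γ.mult s i := by
  have := hs i
  simp only [mult]
  omega

theorem mem_supp_iff (s : Γ.dualLattice) (i : V) : i ∈ Γ.supp s ↔ 0 < Γ.mult s i := by
  simp [supp, mult]

variable {Γ} in
theorem deg_mono {s : Γ.dualLattice} (hs : s ∈ Γ.lipmanCone) : Monotone (Γ.deg s) := by
  intro l m hlm
  rw [deg_eq_sum, deg_eq_sum]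
  exact Finset.sum_le_sum fun i _ => mul_le_mul_of_nonneg_left (hlm i) (mult_nonneg hs i)

variable {Γ} in
theorem deg_nonneg {s : Γ.dualLattice} (hs : s ∈ Γ.lipmanCone) {l : V → ℤ} (hl : 0 ≤ l) :
    0 ≤ Γ.deg s l := by
  have := deg_mono hs hl
  rwa [Γ.deg_eq_sum s 0, Finset.sum_eq_zero fun i _ => by simp] at this

variable {Γ} in
-- The cube covering the barycenter has a base point below that of `c`, and `d` is monotone because
-- all `n_i ≥ 0`.
theorem toSet_subset_level_iff {s : Γ.dualLattice} (hs : s ∈ Γ.lipmanCone) (c : LatticeCube V)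
    (d : ℤ) : c.toSet ⊆ Γ.level s d ↔ 0 ≤ c.base ∧ d ≤ Γ.deg s c.base := by
  constructor
  · intro hc
    obtain ⟨c', hc', hmem⟩ := Set.mem_iUnion₂.1 (hc c.center_mem)
    have hle := LatticeCube.base_le_of_center_mem hmem
    have := deg_mono hs hle
    refine ⟨hc'.1.trans hle, le_trans ?_ this⟩
    have := hc'.2
    simp only [deg]
    omega
  · rintro ⟨h0, hd⟩
    refine Set.subset_iUnion₂_of_subset c ⟨h0, ?_⟩ subset_rfl
    simp only [deg] at hd
    omega

/-! ### Finiteness of the sublevel spaces. -/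

/-- Each coordinate of a vector is bounded in terms of the value of the negative definite form. -/
theorem exists_abs_le_sub_pair_self : ∃ C : ℚ, ∀ (x : V → ℚ) (i : V), |x i| ≤ C - Γ.pair x x := by
  -- Pairing with `dual i` reads off the `i`-th coordinate, so expanding `(±x + dual i, ±x + dual i)
  -- ≤ 0` bounds `±2 x_i`.
  let dual : V → V → ℚ := fun i => (Γ.matQ)⁻¹.mulVec (Pi.single i 1)
  have hdual : ∀ (x : V → ℚ) (i : V), Γ.pair x (dual i) = x i := by
    intro x i
    simp only [pair, dual]
    rw [Matrix.mulVec_mulVec, Matrix.mul_nonsing_inv _ Γ.isUnit_det_matQ, Matrix.one_mulVec,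
      dotProduct_single, mul_one]
  obtain ⟨C, hC⟩ := (Set.finite_range fun i => -Γ.pair (dual i) (dual i)).bddAbove
  refine ⟨C, fun x i => ?_⟩
  have hCi : -Γ.pair (dual i) (dual i) ≤ C := hC ⟨i, rfl⟩
  have h0 := Γ.pair_self_nonpos (dual i)
  have hx := Γ.pair_self_nonpos x
  have h1 := Γ.pair_self_nonpos (x + dual i)
  have h2 := Γ.pair_self_nonpos (-x + dual i)
  simp only [pair_add_left, pair_add_right, pair_neg_left, Γ.pair_comm (dual i) x,
    Γ.pair_comm (dual i) (-x), Γ.pair_comm x (-x)] at h1 h2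
  rw [hdual x i] at h1 h2
  rw [abs_le]
  constructor <;> linarith

theorem finite_chi_le (h : Γ.H) (n : ℤ) : {l | Γ.chi h l ≤ n}.Finite := by
  obtain ⟨C, hC⟩ := Γ.exists_abs_le_sub_pair_self
  set k := Γ.kh h with hk
  -- Completing the square: `-(l + k/2, l + k/2) = 2 χ_h(l) - (k, k)/4`.
  set D : ℚ := C + 2 * n - Γ.pair k k / 4 with hD
  refine (Set.finite_Icc (fun i => ⌊-D - k i / 2⌋) (fun i => ⌈D - k i / 2⌉)).subset ?_
  intro l hl
  have hl' : (Γ.chi h l : ℚ) ≤ n := by exact_mod_cast hl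
  rw [chi_cast, pair_add_right] at hl'
  have e1 : Γ.pair (latQ l) ((1 / 2 : ℚ) • k) = 1 / 2 * Γ.pair (latQ l) k := by
    rw [Γ.pair_comm, pair_smul_left, Γ.pair_comm]
  have e2 : Γ.pair k ((1 / 2 : ℚ) • k) = 1 / 2 * Γ.pair k k := by
    rw [Γ.pair_comm, pair_smul_left]
  have key : ∀ i, |(l i : ℚ) + k i / 2| ≤ D := by
    intro i
    have h1 := hC (latQ l + (1 / 2 : ℚ) • k) i
    simp only [pair_add_left, pair_add_right, pair_smul_left, e1, e2,
      Γ.pair_comm k (latQ l)] at h1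
    simp only [Pi.add_apply, Pi.smul_apply, smul_eq_mul, latQ] at h1
    rw [show (l i : ℚ) + k i / 2 = l i + 1 / 2 * k i by ring]
    refine h1.trans ?_
    change _ ≤ C + 2 * (n : ℚ) - Γ.pair k k / 4
    linarith
  constructor <;> intro i <;> have := abs_le.1 (key i)
  · have h2 := Int.floor_le (-D - k i / 2)
    have h3 : ((⌊-D - k i / 2⌋ : ℤ) : ℚ) ≤ l i := by linarith
    exact_mod_cast h3
  · have h2 := Int.le_ceil (D - k i / 2)
    have h3 : (l i : ℚ) ≤ ((⌈D - k i / 2⌉ : ℤ) : ℚ) := by linarith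
    exact_mod_cast h3

theorem finite_weight_le (h : Γ.H) (n : ℤ) : {c | Γ.weight h c ≤ n}.Finite := by
  refine Set.Finite.subset (((Γ.finite_chi_le h n).prod (Set.finite_univ (α := Finset V))).image
    fun p => ⟨p.1, p.2⟩) ?_
  intro c hc
  exact ⟨(c.base, c.dirs), ⟨(Γ.chi_base_le_weight h c).trans hc, trivial⟩, rfl⟩

/-! ### Vanishing of the contribution of non-effective lattice points. -/

/-- By adjunction the `Z_K` part of `k_h` cancels `(E_i, E_i)` and leaves the constant `1`. So `χ_h`
does not increase along `E_i` once `(l + s_h, E_i) ≥ 1`. -/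
theorem chi_add_E (h : Γ.H) (l : V → ℤ) (i : V) :
    ((Γ.chi h (l + indicatorE {i}) : ℤ) : ℚ) =
      Γ.chi h l + 1 - Γ.matQ.mulVec (latQ l + Γ.leastRep h) i := by
  have h1 : Γ.pair (latQ (indicatorE {i})) (latQ (indicatorE {i})) = (Γ.euler i : ℚ) := by
    rw [pair_E, latQ_indicatorE_singleton, Matrix.mulVec_single_one]
    simp [matQ, intersectionMatrix]
  rw [chi_cast, chi_cast, latQ_add, ← pair_E]
  simp only [pair_add_left, pair_add_right, h1, Γ.pair_comm _ (Γ.kh h),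
    Γ.pair_comm (latQ (indicatorE {i})) (latQ l)]
  simp only [kh, pair_add_left, pair_neg_left, adjunction, pair_smul_left]
  ring

/-- Only the diagonal entries of the form can be negative, and the diagonal term is unchanged. -/
theorem mulVec_mono_of_eq {x y : V → ℚ} (hxy : x ≤ y) {i : V} (hi : x i = y i) :
    Γ.matQ.mulVec x i ≤ Γ.matQ.mulVec y i := by
  unfold Matrix.mulVec dotProduct
  refine Finset.sum_le_sum fun j _ => ?_
  by_cases hij : i = j
  · subst hij; rw [hi]
  · refine mul_le_mul_of_nonneg_left (hxy j) ?_
    simp only [matQ, Matrix.map_apply, intersectionMatrix, hij, if_false]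
    split_ifs <;> simp

/-- If `l` is not effective then some `E_i` in the support of its negative part satisfies
`(l + s_h, E_i) ≥ 1`. -/
theorem exists_one_le_mulVec (h : Γ.H) {l : V → ℤ} (hl : ¬ 0 ≤ l) :
    ∃ i, 1 ≤ Γ.matQ.mulVec (latQ l + Γ.leastRep h) i := by
  set sh := Γ.leastRep h with hsh
  -- If `s_h + m` were in the Lipman cone, minimality of `s_h` would give `m ≥ 0`, that is `l ≥ 0`.
  set m : V → ℤ := l ⊓ 0 with hm
  have hleast := Γ.leastRep_isLeast h
  let w : Γ.dualLattice := sh + ⟨latQ m, Γ.latQ_mem_dualLattice m⟩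
  have hclass : (QuotientAddGroup.mk w : Γ.H) = h := by
    refine Eq.trans ?_ hleast.1.2
    rw [QuotientAddGroup.eq_iff_sub_mem, AddSubgroup.mem_addSubgroupOf]
    simpa [w, hsh] using Γ.mem_lattice_latQ m
  have hnot : w ∉ Γ.lipmanCone := by
    intro hw
    apply hl
    intro i
    have h1 : (sh : V → ℚ) i ≤ (w : V → ℚ) i := hleast.2 ⟨hw, hclass⟩ i
    simp only [w, AddSubgroup.coe_add, Pi.add_apply, latQ, hm] at h1
    have h2 : (0 : ℚ) ≤ ((l i ⊓ 0 : ℤ) : ℚ) := by simpa using h1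
    have h3 : 0 ≤ l i ⊓ 0 := by exact_mod_cast h2
    exact h3.trans inf_le_left
  have hnot' : ∃ i, 0 < Γ.dualPair w (indicatorE {i}) := by
    by_contra hcon
    push Not at hcon
    exact hnot hcon
  obtain ⟨i, hi⟩ := hnot'
  -- Integrality of the pairing improves `> 0` to `≥ 1`.
  have hi1 : (1 : ℚ) ≤ Γ.matQ.mulVec w i := by
    rw [← pair_E, ← dualPair_cast]
    exact_mod_cast hi
  have hsi : Γ.matQ.mulVec sh i ≤ 0 := (Γ.mem_lipmanCone_iff sh).1 hleast.1.1 i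
  have hwQ : (w : V → ℚ) = latQ m + sh := by
    rw [add_comm]; rfl
  -- Where `m` vanishes, `(s_h + m, E_i) ≤ (s_h, E_i) ≤ 0`; so `m i ≠ 0`, and `m` agrees with `l` at
  -- `i`.
  have hmi : m i = l i := by
    by_contra hne
    have h0 : m i = 0 := by
      rcases min_choice (l i) 0 with h | h
      · exact absurd h hne
      · exact h
    have : Γ.matQ.mulVec (w : V → ℚ) i ≤ Γ.matQ.mulVec sh i := by
      refine Γ.mulVec_mono_of_eq (fun j => ?_) ?_
      · have : (m j : ℚ) ≤ 0 := by exact_mod_cast (inf_le_right : l j ⊓ 0 ≤ 0)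
        rw [hwQ]
        simp only [Pi.add_apply, latQ]
        linarith
      · rw [hwQ]
        simp [latQ, h0]
    linarith
  refine ⟨i, hi1.trans (Γ.mulVec_mono_of_eq (fun j => ?_) ?_)⟩
  · have : (m j : ℚ) ≤ l j := by exact_mod_cast (inf_le_left : l j ⊓ 0 ≤ l j)
    rw [hwQ]
    simp only [Pi.add_apply, latQ]
    linarith
  · rw [hwQ]
    simp [latQ, hmi]

/-- If `l` is not effective then adding a suitable direction to a cube based at `l` does not
change its weight. -/
theorem exists_weight_insert_eq (h : Γ.H) {l : V → ℤ} (hl : ¬ 0 ≤ l) :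
    ∃ i, ∀ I : Finset V, i ∉ I → Γ.weight h ⟨l, insert i I⟩ = Γ.weight h ⟨l, I⟩ := by
  obtain ⟨i, hi⟩ := Γ.exists_one_le_mulVec h hl
  refine ⟨i, fun I hiI => le_antisymm ?_ ?_⟩
  · rw [weight_le_iff]
    intro J hJ
    by_cases hiJ : i ∈ J
    · have hJI : J.erase i ⊆ I := Finset.subset_insert_iff.1 hJ
      refine le_trans ?_ (Γ.chi_le_weight h ⟨l, I⟩ hJI)
      have hsplit : indicatorE J = indicatorE (J.erase i) + indicatorE {i} := by
        rw [← indicatorE_union_of_disjoint (by simp), Finset.union_comm, ← Finset.insert_eq,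
          Finset.insert_erase hiJ]
      have h1 := Γ.chi_add_E h (l + indicatorE (J.erase i)) i
      -- Adding `E_j` with `j ≠ i` keeps the `i`-th coordinate, so the inequality `(l + s_h, E_i) ≥
      -- 1` persists at every vertex `l + E_J` with `i ∉ J`.
      have h2 : Γ.matQ.mulVec (latQ l + Γ.leastRep h) i ≤
          Γ.matQ.mulVec (latQ (l + indicatorE (J.erase i)) + Γ.leastRep h) i := by
        refine Γ.mulVec_mono_of_eq (fun j => ?_) ?_
        · simp only [Pi.add_apply, latQ, indicatorE]
          split_ifs <;> simp
        · simp [latQ, indicatorE]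
      simp only [hsplit, ← add_assoc]
      have h3 : ((Γ.chi h (l + indicatorE (J.erase i) + indicatorE {i}) : ℤ) : ℚ) ≤
          Γ.chi h (l + indicatorE (J.erase i)) := by linarith
      exact_mod_cast h3
    · exact Γ.chi_le_weight h ⟨l, I⟩ ((Finset.subset_insert_iff_of_notMem hiJ).1 hJ)
  · rw [weight_le_iff]
    exact fun J hJ => Γ.chi_le_weight h ⟨l, insert i I⟩ (hJ.trans (Finset.subset_insert _ _))

theorem cubeSum_eq_zero (G : Type*) [AddCommGroup G] [PartialOrder G] (h : Γ.H) {l : V → ℤ}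
    (hl : ¬ 0 ≤ l) : Γ.cubeSum G h l = 0 := by
  obtain ⟨i, hi⟩ := Γ.exists_weight_insert_eq h hl
  rw [cubeSum, ← Finset.powerset_univ, ← Finset.insert_erase (Finset.mem_univ i),
    Finset.sum_powerset_insert (Finset.notMem_erase i _), ← Finset.sum_add_distrib]
  refine Finset.sum_eq_zero fun I hI => ?_
  have hiI : i ∉ I := fun h => Finset.notMem_erase i _ (Finset.mem_powerset.1 hI h)
  rw [hi I hiI, Finset.card_insert_of_notMem hiI, pow_succ, mul_neg_one, neg_smul, add_neg_cancel]

end ResolutionGraph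

/-! ### Coefficients of formal sums and division by `1 - Q`. -/

namespace FormalSeries

variable {G : Type*} [AddCommGroup G] [PartialOrder G] [IsOrderedAddMonoid G]

theorem coeff_one_sub_Q_mul (P : HahnSeries (G × ℤ) ℤ) (g : G) (n : ℤ) :
    ((1 - Q G) * P).coeff (g, n) = P.coeff (g, n) - P.coeff (g, n - 1) := by
  rw [sub_mul, one_mul, HahnSeries.coeff_sub, Q, HahnSeries.coeff_single_mul]
  simp

theorem eq_invOneSubQ_mul (P : HahnSeries (G × ℤ) ℤ) : P = invOneSubQ G * ((1 - Q G) * P) := by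
  rw [← mul_assoc, invOneSubQ, Ring.inverse_mul_cancel _ isUnit_one_sub_Q, one_mul]

theorem hasFormalSum_of_coeff {α Γ R : Type*} [PartialOrder Γ] [AddCommMonoid R]
    {f : α → HahnSeries Γ R} {S : HahnSeries Γ R} {t : Set Γ} (ht : t.IsPWO)
    (hsupp : ∀ a, (f a).support ⊆ t) (hfin : ∀ g, {a | (f a).coeff g ≠ 0}.Finite)
    (hS : ∀ g, S.coeff g = ∑ᶠ a, (f a).coeff g) : HasFormalSum f S := by
  refine ⟨⟨f, ht.mono (Set.iUnion_subset hsupp), hfin⟩, fun a => rfl, ?_⟩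
  ext g
  rw [HahnSeries.SummableFamily.coeff_hsum, hS]
  rfl

end FormalSeries

/-! ### Signed cube counts for an arbitrary grading of the lattice. -/

namespace ResolutionGraph

open FormalSeries

variable {V : Type*} [Fintype V] [LinearOrder V] (Γ : ResolutionGraph V)

section Grading

variable {G : Type*}

open Classical in
/-- The cubes `(l, I)` of weight at most `n` with `l ≥ 0` and `l` of degree `g`. -/
noncomputable def gradedCubes (h : Γ.H) (γ : (V → ℤ) → G) (g : G) (n : ℤ) :
    Finset (LatticeCube V) :=
  (Γ.finite_weight_le h n).toFinset.filter fun c => 0 ≤ c.base ∧ γ c.base = g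

theorem mem_gradedCubes {h : Γ.H} {γ : (V → ℤ) → G} {g : G} {n : ℤ} {c : LatticeCube V} :
    c ∈ Γ.gradedCubes h γ g n ↔ Γ.weight h c ≤ n ∧ 0 ≤ c.base ∧ γ c.base = g := by
  simp [gradedCubes]

open Classical in
theorem sum_gradedCubes_sub (h : Γ.H) (γ : (V → ℤ) → G) (g : G) (n : ℤ) :
    ∑ c ∈ Γ.gradedCubes h γ g n, (-1 : ℤ) ^ c.dirs.card -
      ∑ c ∈ Γ.gradedCubes h γ g (n - 1), (-1 : ℤ) ^ c.dirs.card =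
    ∑ c ∈ Γ.gradedCubes h γ g n with Γ.weight h c = n, (-1 : ℤ) ^ c.dirs.card := by
  have : Γ.gradedCubes h γ g (n - 1) =
      (Γ.gradedCubes h γ g n).filter fun c => ¬ Γ.weight h c = n := by
    ext c
    simp only [Finset.mem_filter, mem_gradedCubes]
    constructor
    · rintro ⟨h1, h2⟩
      exact ⟨⟨by omega, h2⟩, by omega⟩
    · rintro ⟨⟨h1, h2⟩, h3⟩
      exact ⟨by omega, h2⟩
  rw [this, ← Finset.sum_filter_add_sum_filter_not (Γ.gradedCubes h γ g n)
    (fun c => Γ.weight h c = n)]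
  ring

variable [AddCommGroup G] [PartialOrder G] [IsOrderedAddMonoid G]

open Classical in
theorem coeff_cube_term (h : Γ.H) (γ : (V → ℤ) → G) (c : LatticeCube V) (g : G) (n : ℤ) :
    ((-1 : ℤ) ^ c.dirs.card • (HahnSeries.single (γ c.base, (0 : ℤ)) (1 : ℤ) *
      HahnSeries.single (0, Γ.weight h c) (1 : ℤ))).coeff (g, n) =
    if γ c.base = g ∧ Γ.weight h c = n then (-1) ^ c.dirs.card else 0 := by
  rw [HahnSeries.single_mul_single, HahnSeries.coeff_smul, HahnSeries.coeff_single]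
  simp [Prod.ext_iff, eq_comm]

theorem single_mul_cubeSum (h : Γ.H) (x : HahnSeries (G × ℤ) ℤ) (l : V → ℤ) :
    x * Γ.cubeSum G h l = ∑ I : Finset V, (-1 : ℤ) ^ I.card •
      (x * HahnSeries.single (0, Γ.weight h ⟨l, I⟩) (1 : ℤ)) := by
  rw [cubeSum, Finset.mul_sum]
  refine Finset.sum_congr rfl fun I _ => ?_
  rcases neg_one_pow_eq_or ℤ I.card with hI | hI <;> rw [hI]
  · rw [one_smul, one_smul]
  · rw [neg_smul, one_smul, neg_smul, one_smul, mul_neg]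

open Classical in
theorem coeff_lattice_term (h : Γ.H) (γ : (V → ℤ) → G) (l : V → ℤ) (g : G) (n : ℤ) :
    (HahnSeries.single (γ l, (0 : ℤ)) (1 : ℤ) * Γ.cubeSum G h l).coeff (g, n) =
    ∑ I : Finset V, if γ l = g ∧ Γ.weight h ⟨l, I⟩ = n then (-1) ^ I.card else 0 := by
  rw [single_mul_cubeSum, HahnSeries.coeff_sum]
  exact Finset.sum_congr rfl fun I _ => Γ.coeff_cube_term h γ ⟨l, I⟩ g n

theorem exists_weight_ge (h : Γ.H) : ∃ m : ℤ, ∀ c, m ≤ Γ.weight h c := by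
  obtain ⟨m, hm⟩ := Γ.exists_chi_ge h
  exact ⟨m, fun c => (hm _).trans (Γ.chi_base_le_weight h c)⟩

open Classical in
-- One well-ordered bound serves the sums over cubes, over `l ≥ 0` and over all `l`: degrees are
-- controlled only for `l ≥ 0`, but the remaining lattice terms are zero.
theorem exists_isPWO_support (h : Γ.H) {γ : (V → ℤ) → G} {u : Set G} (hu : u.IsPWO)
    (hγ : ∀ l, 0 ≤ l → γ l ∈ u) : ∃ t : Set (G × ℤ), t.IsPWO ∧
      (∀ c : LatticeCube V, 0 ≤ c.base → ((-1 : ℤ) ^ c.dirs.card •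
        (HahnSeries.single (γ c.base, (0 : ℤ)) (1 : ℤ) *
          HahnSeries.single (0, Γ.weight h c) (1 : ℤ))).support ⊆ t) ∧
      ∀ l, (HahnSeries.single (γ l, (0 : ℤ)) (1 : ℤ) * Γ.cubeSum G h l).support ⊆ t := by
  obtain ⟨m, hm⟩ := Γ.exists_weight_ge h
  refine ⟨u ×ˢ Set.Ici m, hu.prod (isPWO_Ici_int m), ?_, ?_⟩
  · rintro c hc ⟨g, n⟩ hg
    rw [HahnSeries.mem_support, coeff_cube_term] at hg
    obtain ⟨⟨rfl, rfl⟩, -⟩ := ite_ne_right_iff.1 hg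
    exact ⟨hγ _ hc, hm c⟩
  · rintro l ⟨g, n⟩ hg
    by_cases hl : 0 ≤ l
    · rw [HahnSeries.mem_support, coeff_lattice_term] at hg
      obtain ⟨I, -, hI⟩ := Finset.exists_ne_zero_of_sum_ne_zero hg
      obtain ⟨⟨rfl, rfl⟩, -⟩ := ite_ne_right_iff.1 hI
      exact ⟨hγ _ hl, hm _⟩
    · rw [Γ.cubeSum_eq_zero G h hl] at hg
      simp at hg

variable {P : HahnSeries (G × ℤ) ℤ} {h : Γ.H} {γ : (V → ℤ) → G} {u : Set G}

variable {Γ} in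
-- If `P` counts cubes of weight at most `n`, then `(1 - Q) P` counts those of weight exactly `n`.
-- The grading `γ` is kept general so that the one-variable and multivariable series can be treated
-- alike.
theorem hasFormalSum_cubes (hu : u.IsPWO) (hγ : ∀ l, 0 ≤ l → γ l ∈ u)
    (hP : ∀ g n, P.coeff (g, n) = ∑ c ∈ Γ.gradedCubes h γ g n, (-1 : ℤ) ^ c.dirs.card) :
    HasFormalSum (fun c : {c : LatticeCube V // c.toSet ⊆ Γ.quadrant} =>
      (-1 : ℤ) ^ c.1.dirs.card • (HahnSeries.single (γ c.1.base, (0 : ℤ)) (1 : ℤ) *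
        HahnSeries.single (0, Γ.weight h c.1) (1 : ℤ))) ((1 - Q G) * P) := by
  classical
  obtain ⟨t, ht, hc, -⟩ := Γ.exists_isPWO_support h hu hγ
  have hsub : ∀ g n, (Function.support fun c : {c : LatticeCube V // c.toSet ⊆ Γ.quadrant} =>
      if γ c.1.base = g ∧ Γ.weight h c.1 = n then (-1 : ℤ) ^ c.1.dirs.card else 0) ⊆
      Subtype.val ⁻¹' (Γ.gradedCubes h γ g n : Set (LatticeCube V)) := by
    rintro g n c hg
    obtain ⟨⟨rfl, rfl⟩, -⟩ := ite_ne_right_iff.1 hg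
    exact Γ.mem_gradedCubes.2 ⟨le_rfl, (Γ.toSet_subset_quadrant_iff c.1).1 c.2, rfl⟩
  refine hasFormalSum_of_coeff ht
    (fun c => hc c.1 ((Γ.toSet_subset_quadrant_iff c.1).1 c.2)) ?_ ?_
  · rintro ⟨g, n⟩
    simp only [coeff_cube_term]
    exact ((Finset.finite_toSet _).preimage Subtype.val_injective.injOn).subset (hsub g n)
  · rintro ⟨g, n⟩
    simp only [coeff_cube_term]
    rw [coeff_one_sub_Q_mul, hP, hP, sum_gradedCubes_sub,
      finsum_eq_sum_of_support_subset (s := (Γ.gradedCubes h γ g n).subtype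
        fun c => c.toSet ⊆ Γ.quadrant) _ (fun c hc => by simpa using hsub g n hc),
      Finset.sum_subtype_of_mem (fun c : LatticeCube V =>
        if γ c.base = g ∧ Γ.weight h c = n then (-1 : ℤ) ^ c.dirs.card else 0)
        (fun c hc => (Γ.toSet_subset_quadrant_iff c).2 (Γ.mem_gradedCubes.1 hc).2.1),
      Finset.sum_filter]
    refine Finset.sum_congr rfl fun c hc => ?_
    simp [(Γ.mem_gradedCubes.1 hc).2.2]

variable {Γ} in
theorem hasFormalSum_lattice (hu : u.IsPWO) (hγ : ∀ l, 0 ≤ l → γ l ∈ u)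
    (hP : ∀ g n, P.coeff (g, n) = ∑ c ∈ Γ.gradedCubes h γ g n, (-1 : ℤ) ^ c.dirs.card) :
    HasFormalSum (fun l : V → ℤ =>
      HahnSeries.single (γ l, (0 : ℤ)) (1 : ℤ) * Γ.cubeSum G h l) ((1 - Q G) * P) := by
  classical
  obtain ⟨t, ht, -, hl⟩ := Γ.exists_isPWO_support h hu hγ
  have hsub : ∀ g n, (Function.support fun l : V → ℤ =>
      (HahnSeries.single (γ l, (0 : ℤ)) (1 : ℤ) * Γ.cubeSum G h l).coeff (g, n)) ⊆
      ((Γ.gradedCubes h γ g n).image LatticeCube.base : Finset (V → ℤ)) := by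
    intro g n l hg
    by_cases h0 : 0 ≤ l
    · rw [Function.mem_support, coeff_lattice_term] at hg
      obtain ⟨I, -, hI⟩ := Finset.exists_ne_zero_of_sum_ne_zero hg
      obtain ⟨⟨rfl, rfl⟩, -⟩ := ite_ne_right_iff.1 hI
      exact Finset.mem_image.2 ⟨⟨l, I⟩, Γ.mem_gradedCubes.2 ⟨le_rfl, h0, rfl⟩, rfl⟩
    · rw [Function.mem_support, Γ.cubeSum_eq_zero G h h0] at hg
      simp at hg
  refine hasFormalSum_of_coeff ht hl ?_ ?_
  · rintro ⟨g, n⟩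
    exact (Finset.finite_toSet _).subset (hsub g n)
  · rintro ⟨g, n⟩
    rw [coeff_one_sub_Q_mul, hP, hP, sum_gradedCubes_sub,
      finsum_eq_sum_of_support_subset _ (hsub g n)]
    simp only [coeff_lattice_term]
    rw [Finset.sum_sigma', ← Finset.sum_filter]
    -- A cube is its base point together with its set of directions.
    refine Finset.sum_bij' (fun c _ => ⟨c.base, c.dirs⟩) (fun p _ => ⟨p.1, p.2⟩) ?_ ?_ ?_ ?_ ?_
    · intro c hc
      obtain ⟨hc, hw⟩ := Finset.mem_filter.1 hc
      exact Finset.mem_filter.2 ⟨Finset.mem_sigma.2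
        ⟨Finset.mem_image_of_mem _ hc, Finset.mem_univ _⟩, (Γ.mem_gradedCubes.1 hc).2.2, hw⟩
    · rintro ⟨l, I⟩ hp
      obtain ⟨hp, hg, hw⟩ := Finset.mem_filter.1 hp
      obtain ⟨c, hc, hcl⟩ := Finset.mem_image.1 (Finset.mem_sigma.1 hp).1
      refine Finset.mem_filter.2 ⟨Γ.mem_gradedCubes.2 ⟨hw.le, ?_, hg⟩, hw⟩
      rw [← hcl]
      exact (Γ.mem_gradedCubes.1 hc).2.1
    · exact fun _ _ => rfl
    · exact fun _ _ => rfl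
    · exact fun _ _ => rfl

variable {Γ} in
theorem hasFormalSum_nonneg_lattice (hu : u.IsPWO) (hγ : ∀ l, 0 ≤ l → γ l ∈ u)
    (hP : ∀ g n, P.coeff (g, n) = ∑ c ∈ Γ.gradedCubes h γ g n, (-1 : ℤ) ^ c.dirs.card) :
    HasFormalSum (fun l : {l : V → ℤ // 0 ≤ l} =>
      HahnSeries.single (γ l.1, (0 : ℤ)) (1 : ℤ) * Γ.cubeSum G h l.1) ((1 - Q G) * P) := by
  obtain ⟨F, hF, hsum⟩ := hasFormalSum_lattice hu hγ hP
  replace hF : ∀ l, F l = HahnSeries.single (γ l, (0 : ℤ)) (1 : ℤ) * Γ.cubeSum G h l := hF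
  refine hasFormalSum_of_coeff (F.isPWO_iUnion_support)
    (fun l => ?_) (fun g => ?_) (fun g => ?_)
  · rw [← hF]
    exact Set.subset_iUnion (fun l => (F l).support) l.1
  · simp only [← hF]
    exact (F.finite_co_support g).preimage Subtype.val_injective.injOn
  · rw [← hsum, HahnSeries.SummableFamily.coeff_hsum]
    simp only [← hF]
    rw [finsum_subtype_eq_finsum_cond (f := fun l => (F l).coeff g) (fun l => 0 ≤ l)]
    refine finsum_congr fun l => ?_
    by_cases hl : 0 ≤ l
    · simp [hl]
    · simp [hl, hF, Γ.cubeSum_eq_zero G h hl]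

end Grading

/-! ### The coefficients of both series at `𝔥 = -1` as signed cube counts. -/

section Rank

variable {Γ} {h : Γ.H} {s : Γ.dualLattice}

theorem sum_rankE1 (hs : s ∈ Γ.lipmanCone) (d n : ℤ) :
    ∑ b ∈ Finset.range (Fintype.card V + 1), (-1 : ℤ) ^ b * (Γ.rankE1 h s d n b : ℤ) =
      ∑ c ∈ Γ.gradedCubes h (Γ.deg s) d n, (-1 : ℤ) ^ c.dirs.card := by
  classical
  have hsub : Γ.sublevel h n ∩ Γ.level s (d + 1) ⊆ Γ.sublevel h n ∩ Γ.level s d := by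
    refine Set.inter_subset_inter_right _ (Set.iUnion₂_subset fun c hc => ?_)
    exact Set.subset_iUnion₂_of_subset c ⟨hc.1, by have := hc.2; omega⟩ subset_rfl
  simp only [rankE1]
  rw [LatticeCube.sum_relBetti hsub
    ((Γ.finite_weight_le h n).toFinset.filter fun c => 0 ≤ c.base ∧ d ≤ Γ.deg s c.base)
    (fun c => by
      rw [Set.subset_inter_iff, toSet_subset_sublevel_iff, toSet_subset_level_iff hs]
      simp)]
  refine Finset.sum_congr ?_ fun _ _ => rfl
  ext c
  simp only [Finset.mem_filter, Set.Finite.mem_toFinset, Set.mem_ofPred_eq, mem_gradedCubes,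
    Set.subset_inter_iff, toSet_subset_sublevel_iff, toSet_subset_level_iff hs]
  constructor
  · rintro ⟨⟨h1, h2, h3⟩, h4⟩
    refine ⟨h1, h2, le_antisymm ?_ h3⟩
    by_contra hlt
    exact h4 ⟨h1, h2, by omega⟩
  · rintro ⟨h1, h2, h3⟩
    exact ⟨⟨h1, h2, h3.ge⟩, fun h4 => by omega⟩

theorem extendSupp_nonneg (s : Γ.dualLattice) (k : Γ.supp s → ℕ) : 0 ≤ Γ.extendSupp s k := by
  intro i
  simp only [extendSupp, Pi.zero_apply]
  split_ifs <;> simp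

/-- Termwise `n_i l_i` dominates the corresponding term for `k`, so the sums can compare this way
only if all terms agree; off the support `n_i = 0`. -/
theorem deg_le_deg_extendSupp_iff (hs : s ∈ Γ.lipmanCone) (k : Γ.supp s → ℕ) {l : V → ℤ}
    (hl : Γ.extendSupp s k ≤ l) :
    Γ.deg s l ≤ Γ.deg s (Γ.extendSupp s k) ↔
      ∀ i : Γ.supp s, Γ.mult s i * l i = Γ.mult s i * k i := by
  have hle : ∀ i ∈ Finset.univ, Γ.mult s i * Γ.extendSupp s k i ≤ Γ.mult s i * l i :=
    fun i _ => mul_le_mul_of_nonneg_left (hl i) (mult_nonneg hs i)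
  have hext : ∀ i : Γ.supp s, Γ.extendSupp s k i = k i := fun i => by simp [extendSupp]
  rw [deg_eq_sum, deg_eq_sum]
  constructor
  · intro h i
    rw [← hext]
    exact ((Finset.sum_eq_sum_iff_of_le hle).1
      (le_antisymm (Finset.sum_le_sum hle) h) i (Finset.mem_univ _)).symm
  · intro h
    refine (Finset.sum_congr rfl fun i _ => ?_).le
    by_cases hi : i ∈ Γ.supp s
    · have := h ⟨i, hi⟩
      rwa [← hext] at this
    · have h0 : Γ.mult s i = 0 :=
        le_antisymm (not_lt.1 fun h => hi ((Γ.mem_supp_iff s i).2 h)) (mult_nonneg hs i)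
      simp [h0]

theorem sum_rankMultiE1 (hs : s ∈ Γ.lipmanCone) (k : Γ.supp s → ℕ) (n : ℤ) :
    ∑ b ∈ Finset.range (Fintype.card V + 1), (-1 : ℤ) ^ b * (Γ.rankMultiE1 h s k n b : ℤ) =
      ∑ c ∈ Γ.gradedCubes h (fun l (i : Γ.supp s) => Γ.mult s i * l i)
        (fun i : Γ.supp s => Γ.mult s i * k i) n, (-1 : ℤ) ^ c.dirs.card := by
  classical
  simp only [rankMultiE1]
  rw [LatticeCube.sum_relBetti Set.inter_subset_left
    ((Γ.finite_weight_le h n).toFinset.filter fun c => Γ.extendSupp s k ≤ c.base)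
    (fun c => by
      rw [Set.subset_inter_iff, toSet_subset_sublevel_iff, toSet_subset_multiLevel_iff]
      simp)]
  refine Finset.sum_congr ?_ fun _ _ => rfl
  ext c
  simp only [Finset.mem_filter, Set.Finite.mem_toFinset, Set.mem_ofPred_eq, mem_gradedCubes,
    Set.subset_inter_iff, toSet_subset_sublevel_iff, toSet_subset_level_iff hs,
    toSet_subset_multiLevel_iff]
  constructor
  · rintro ⟨⟨h1, h2⟩, h4⟩
    have h0 := (extendSupp_nonneg s k).trans h2
    refine ⟨h1, h0, funext ((deg_le_deg_extendSupp_iff hs k h2).1 ?_)⟩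
    by_contra hlt
    exact h4 ⟨⟨h1, h2⟩, h0, by omega⟩
  · rintro ⟨h1, h2, h3⟩
    have hle : Γ.extendSupp s k ≤ c.base := by
      intro i
      by_cases hi : i ∈ Γ.supp s
      · have h5 : Γ.mult s i * c.base i = Γ.mult s i * k ⟨i, hi⟩ := congrFun h3 ⟨i, hi⟩
        have h6 := mul_left_cancel₀ ((Γ.mem_supp_iff s i).1 hi).ne' h5
        simp [extendSupp, hi, h6]
      · simpa [extendSupp, hi] using h2 i
    have := (deg_le_deg_extendSupp_iff hs k hle).2 (congrFun h3)
    exact ⟨⟨h1, hle⟩, fun h4 => by have := h4.2.2; omega⟩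

theorem coeff_map_PE1 (hs : s ∈ Γ.lipmanCone) (d n : ℤ) :
    ((Γ.PE1 h s).map (Polynomial.evalRingHom (-1 : ℤ))).coeff (d, n) =
      ∑ c ∈ Γ.gradedCubes h (Γ.deg s) d n, (-1 : ℤ) ^ c.dirs.card := by
  rw [HahnSeries.map_coeff]
  simp only [PE1]
  split_ifs with hd
  · rw [← sum_rankE1 hs, map_sum]
    simp [Polynomial.eval_monomial, mul_comm]
  -- For `d < 0` the coefficient is `0` by definition, and no effective cube has negative degree.
  · rw [map_zero, Finset.sum_eq_zero]
    intro c hc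
    obtain ⟨-, h0, rfl⟩ := Γ.mem_gradedCubes.1 hc
    exact absurd (deg_nonneg hs h0) hd

/-- Since `n_i > 0` on the support, the exponents `n_i k_i` determine `k`, so at most one `k`
contributes to a monomial. -/
theorem coeff_map_multiPE1 (hs : s ∈ Γ.lipmanCone) (g : Γ.supp s → ℤ) (n : ℤ) :
    ((Γ.multiPE1 h s).map (Polynomial.evalRingHom (-1 : ℤ))).coeff (g, n) =
      ∑ c ∈ Γ.gradedCubes h (fun l (i : Γ.supp s) => Γ.mult s i * l i) g n,
        (-1 : ℤ) ^ c.dirs.card := by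
  rw [HahnSeries.map_coeff]
  simp only [multiPE1]
  by_cases hg : ∃ k : Γ.supp s → ℕ, ∀ i, g i = Γ.mult s i * k i
  · obtain ⟨k, hk⟩ := hg
    have hk' : g = fun i : Γ.supp s => Γ.mult s i * k i := funext hk
    rw [finsum_eq_single _ k, finsum_eq_if, if_pos hk, hk', ← sum_rankMultiE1 hs, map_sum]
    · simp [Polynomial.eval_monomial, mul_comm]
    · intro k' hne
      rw [finsum_eq_if, if_neg]
      intro hk2
      refine hne (funext fun i => ?_)
      have h1 := mul_left_cancel₀ ((Γ.mem_supp_iff s i).1 i.2).ne' ((hk2 i).symm.trans (hk i))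
      exact_mod_cast h1
  · push Not at hg
    rw [finsum_eq_zero_of_forall_eq_zero, map_zero, Finset.sum_eq_zero]
    -- An effective cube of degree `g` would supply such a `k` from its own base coordinates.
    · intro c hc
      obtain ⟨-, h0, rfl⟩ := Γ.mem_gradedCubes.1 hc
      obtain ⟨i, hi⟩ := hg fun i => (c.base i).toNat
      have h1 : 0 ≤ c.base i := h0 i
      rw [Int.toNat_of_nonneg h1] at hi
      exact absurd rfl hi
    · intro k
      rw [finsum_eq_if, if_neg]
      push Not
      exact hg k

end Rank

end ResolutionGraph
-- The main theorem.
theorem mainTheorem7 {V : Type*} [Fintype V] [LinearOrder V] (Γ : ResolutionGraph V)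
    (h : Γ.H) (s : Γ.dualLattice) (hs : s ∈ Γ.lipmanCone) (hs0 : s ≠ 0) :
    -- the sum over all cubes of the first quadrant
    (∃ S : HahnSeries (ℤ × ℤ) ℤ,
      FormalSeries.HasFormalSum
        (fun c : {c : LatticeCube V // c.toSet ⊆ Γ.quadrant} =>
          (-1 : ℤ) ^ c.1.dirs.card •
            (Γ.monT s c.1.base * HahnSeries.single (0, Γ.weight h c.1) (1 : ℤ))) S ∧
      (Γ.PE1 h s).map (Polynomial.evalRingHom (-1 : ℤ)) = FormalSeries.invOneSubQ ℤ * S) ∧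
    -- the sum over the nonnegative lattice points
    (∃ S : HahnSeries (ℤ × ℤ) ℤ,
      FormalSeries.HasFormalSum
        (fun l : {l : V → ℤ // 0 ≤ l} => Γ.monT s l.1 * Γ.cubeSum ℤ h l.1) S ∧
      (Γ.PE1 h s).map (Polynomial.evalRingHom (-1 : ℤ)) = FormalSeries.invOneSubQ ℤ * S) ∧
    -- the sum over the whole lattice
    (∃ S : HahnSeries (ℤ × ℤ) ℤ,
      FormalSeries.HasFormalSum (fun l : V → ℤ => Γ.monT s l * Γ.cubeSum ℤ h l) S ∧
      (Γ.PE1 h s).map (Polynomial.evalRingHom (-1 : ℤ)) = FormalSeries.invOneSubQ ℤ * S) ∧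
    -- the multivariable series, over the nonnegative lattice points and over the whole lattice
    (∃ S : HahnSeries ((Γ.supp s → ℤ) × ℤ) ℤ,
      FormalSeries.HasFormalSum
        (fun l : {l : V → ℤ // 0 ≤ l} =>
          Γ.monMultiT s l.1 * Γ.cubeSum (Γ.supp s → ℤ) h l.1) S ∧
      (Γ.multiPE1 h s).map (Polynomial.evalRingHom (-1 : ℤ)) =
        FormalSeries.invOneSubQ (Γ.supp s → ℤ) * S) ∧
    (∃ S : HahnSeries ((Γ.supp s → ℤ) × ℤ) ℤ,
      FormalSeries.HasFormalSum
        (fun l : V → ℤ => Γ.monMultiT s l * Γ.cubeSum (Γ.supp s → ℤ) h l) S ∧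
      (Γ.multiPE1 h s).map (Polynomial.evalRingHom (-1 : ℤ)) =
        FormalSeries.invOneSubQ (Γ.supp s → ℤ) * S) := by
  have hu : (Set.Ici (0 : ℤ)).IsPWO := FormalSeries.isPWO_Ici_int 0
  have hγ : ∀ l : V → ℤ, 0 ≤ l → Γ.deg s l ∈ Set.Ici (0 : ℤ) :=
    fun _ hl => ResolutionGraph.deg_nonneg hs hl
  have hP := ResolutionGraph.coeff_map_PE1 (h := h) hs
  have hu' : (Set.univ.pi fun _ : Γ.supp s => Set.Ici (0 : ℤ)).IsPWO :=
    Set.IsPWO.pi fun _ => FormalSeries.isPWO_Ici_int 0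
  let γ : (V → ℤ) → Γ.supp s → ℤ := fun l i => Γ.mult s i * l i
  have hγ' : ∀ l : V → ℤ, 0 ≤ l → γ l ∈
      Set.univ.pi fun _ : Γ.supp s => Set.Ici (0 : ℤ) :=
    fun l hl i _ => mul_nonneg (ResolutionGraph.mult_nonneg hs i) (hl i)
  have hP' := ResolutionGraph.coeff_map_multiPE1 (h := h) hs
  have h1 := FormalSeries.eq_invOneSubQ_mul
    ((Γ.PE1 h s).map (Polynomial.evalRingHom (-1 : ℤ)))
  have h2 := FormalSeries.eq_invOneSubQ_mul
    ((Γ.multiPE1 h s).map (Polynomial.evalRingHom (-1 : ℤ)))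
  unfold ResolutionGraph.monT ResolutionGraph.monMultiT
  -- In every clause the witness `S` is `1 - Q` times the series at `𝔥 = -1`.
  exact ⟨⟨_, ResolutionGraph.hasFormalSum_cubes (γ := Γ.deg s) hu hγ hP, h1⟩,
    ⟨_, ResolutionGraph.hasFormalSum_nonneg_lattice (γ := Γ.deg s) hu hγ hP, h1⟩,
    ⟨_, ResolutionGraph.hasFormalSum_lattice (γ := Γ.deg s) hu hγ hP, h1⟩,
    ⟨_, ResolutionGraph.hasFormalSum_nonneg_lattice (γ := γ) hu' hγ' hP', h2⟩,
    ⟨_, ResolutionGraph.hasFormalSum_lattice (γ := γ) hu' hγ' hP', h2⟩⟩
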